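/- **Setting.** Let $M$ be a Hausdorff complex surface with a holomorphic symplectic form $\Omega$, and let $f:M\to N$ be a proper holomorphic map to a Riemann surface with a holomorphic section $\sigma$; let $N_0\subset N$ be the set of regular values of $f$, and assume that the fibres over $N_0$ are connected (so they are elliptic curves). For example, $M$ may be a projective elliptically fibered K3 surface over $N=\mathbb{CP}^1$ with a section. Over small open sets $U\subset N_0$ there are *adapted coordinates*: a holomorphic coordinate $w$ on $U$, a holomorphic period $\tau(w)$ with $\mathrm{Im}\,\tau>0$, and a holomorphic map $p:U\times\mathbb C\to f^{-1}(U)$ over $U$, inducing $(U\times\mathbb C)/\mathrm{Span}_{\mathbb Z}\{1,\tau\}\cong f^{-1}(U)$, with $p(w,0)=\sigma(w)$ and $p^*\Omega=dw\wedge dz$. (Equivalently, $f^{-1}(N_0)=T^*N_0/\Lambda$ symplectically, with $\Lambda|_U=\mathrm{Span}_{\mathbb Z}\{dw,\tau\,dw\}$.) Put $\theta=dz-\frac{\mathrm{Im}\,z}{\mathrm{Im}\,\tau}\frac{\partial\tau}{\partial w}\,dw$. The semi-flat form $\omega_t^{SF}$ on $f^{-1}(N_0)$ is given in all adapted coordinates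 by $$\omega_t^{SF}=\tfrac i2\Big(\tfrac{t}{\mathrm{Im}\,\tau}\,\theta\wedge\bar\theta+\mathrm{Im}\,\tau\;dw\wedge d\bar w\Big).$$ Let $N^o\subset N_0$ be open and let $D^o\subset f^{-1}(N^o)$ be a smooth holomorphic curve such that $f|_{D^o}:D^o\to N^o$ is an unbranched $n$-sheeted covering. Let $\Theta\in H^1(D^o,\mathcal U_c(1))$, where $\mathcal U_c(1)$ is the sheaf of locally constant $U(1)$-valued functions. **The Fourier–Mukai class.** Choose a cover of $N^o$ by domains $U_\lambda$ of adapted coordinates $(w_\lambda,z_\lambda)$, with periods $\tau_\lambda$, over which $D^o$ is the disjoint union of sheets $U_\lambda^j=\{z_\lambda=q_\lambda^j(w_\lambda)\}$, $j=1,\dots,n$, with $q_\lambda^j$ holomorphic, and a cocycle $g_{\mu\lambda}^{ij}$ on the cover $\{U_\lambda^j\}$ of $D^o$ representing $\Theta$. Over $f^{-1}(U_\lambda)$ let $$\Xi_\lambda=\frac{\pi}{\mathrm{Im}\,\tau_\lambda}\big(\mathrm{diag}(q_\lambda^1,\dots,q_\lambda^n)\,\bar\theta-\mathrm{diag}(\bar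 q_\lambda^1,\dots,\bar q_\lambda^n)\,\theta\big).$$ These forms define a $U(n)$-connection on the Hermitian bundle over $f^{-1}(N^o)$ with the following transition functions $G_{\mu\lambda}$, so that $\Xi_\lambda=G_{\mu\lambda}^{-1}\Xi_\mu G_{\mu\lambda}+G_{\mu\lambda}^{-1}dG_{\mu\lambda}$. The entry $(i,j)$ of $G_{\mu\lambda}$ is $0$ at points over which $U_\mu^i$ and $U_\lambda^j$ do not meet. Where they meet, $q_\lambda^j\,dw_\lambda-q_\mu^i\,dw_\mu=(r+s\tau_\lambda)\,dw_\lambda$ with integers $r,s$, and the entry is $g_{\mu\lambda}^{ij}\exp\big(2\pi i(s y_1-r y_2)\big)$, where $z_\lambda=y_1+\tau_\lambda y_2$ with $y_1,y_2$ real. (This bundle is the push-forward to $f^{-1}(N^o)$ of the flat line bundle of $\Theta$ twisted by the Poincaré line bundle on $D^o\times_{N^o}f^{-1}(N^o)$.) The class $\mathcal{FM}(D^o,\Theta)$ consists of all unitary connections on Hermitian bundles over $f^{-1}(N^o)$ that are unitarily gauge equivalent to a connection obtained in this way. **Proposition.** For every $\Theta\in H^1(D^o,\mathcal U_c(1))$,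 every $\Xi\in\mathcal{FM}(D^o,\Theta)$ and every $t\in(0,1]$, the connection $\Xi$ is anti-self-dual with respect to the semi-flat hyperkähler structure $(\omega_t^{SF},\Omega)$, i.e. its curvature $F_\Xi$ satisfies $$F_\Xi\wedge\omega_t^{SF}=0\qquad\text{and}\qquad F_\Xi\wedge\Omega=0 .$$ -/

import Mathlib

open scoped Manifold ContDiff Topology ComplexConjugate

noncomputable section

namespace SemiFlatFM

universe u v

/-! ## Forms on a complex surface, regarded as a real 4-manifold -/

section Forms

variable (M : Type u) [TopologicalSpace M] [ChartedSpace (ℂ × ℂ) M]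

/-- Complex valued differential 1-forms (no regularity included). -/
abbrev OneForm : Type u := ∀ x : M, TangentSpace 𝓘(ℝ, ℂ × ℂ) x →L[ℝ] ℂ

/-- Complex valued 2-forms, evaluated on pairs of tangent vectors. -/
abbrev TwoForm : Type u :=
  ∀ x : M, TangentSpace 𝓘(ℝ, ℂ × ℂ) x → TangentSpace 𝓘(ℝ, ℂ × ℂ) x → ℂ

variable {M}

/-- The 1-form `α` in the preferred chart at `x₀`: its pullback by the inverse of that chart. -/
def OneForm.inChart (α : OneForm M) (x₀ : M) (y : ℂ × ℂ) : (ℂ × ℂ) →L[ℝ] ℂ :=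
  (α ((chartAt (ℂ × ℂ) x₀).symm y)).comp
    (mfderiv 𝓘(ℝ, ℂ × ℂ) 𝓘(ℝ, ℂ × ℂ) (chartAt (ℂ × ℂ) x₀).symm y)

/-- Smoothness of a 1-form at every point of the (open) set `V`. -/
def OneForm.SmoothOn (α : OneForm M) (V : Set M) : Prop :=
  ∀ x ∈ V, ContDiffAt ℝ ∞ (α.inChart x) (chartAt (ℂ × ℂ) x x)

/-- The exterior derivative of a 1-form, computed at `x` in the preferred chart at `x`
(whose differential at `x` is the identification of the tangent space at `x` with `ℂ × ℂ`). -/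
def OneForm.d (α : OneForm M) : TwoForm M := fun x v v' =>
  extDeriv (fun y => ContinuousAlternatingMap.ofSubsingleton ℝ (ℂ × ℂ) ℂ (0 : Fin 1)
    (α.inChart x y)) (chartAt (ℂ × ℂ) x x) (![v, v'] : Fin 2 → ℂ × ℂ)

/-- The value of the 4-form `F ∧ G` on four tangent vectors, for 2-forms `F` and `G`
(sum over the six shuffles). -/
def TwoForm.wedge (F G : TwoForm M) (x : M) (v₁ v₂ v₃ v₄ : TangentSpace 𝓘(ℝ, ℂ × ℂ) x) : ℂ :=
  F x v₁ v₂ * G x v₃ v₄ - F x v₁ v₃ * G x v₂ v₄ + F x v₁ v₄ * G x v₂ v₃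
    + F x v₂ v₃ * G x v₁ v₄ - F x v₂ v₄ * G x v₁ v₃ + F x v₃ v₄ * G x v₁ v₂

/-- The entrywise differential of a matrix valued function. -/
def matD {n : ℕ} (s : M → Matrix (Fin n) (Fin n) ℂ) (x : M) (v : TangentSpace 𝓘(ℝ, ℂ × ℂ) x) :
    Matrix (Fin n) (Fin n) ℂ :=
  Matrix.of fun i j => (mfderiv 𝓘(ℝ, ℂ × ℂ) 𝓘(ℝ, ℂ) (fun y => s y i j) x v : ℂ)

/-- A smooth map from the open set `V` to `U(n)`. -/
structure IsSmoothUnitary {n : ℕ} (s : M → Matrix (Fin n) (Fin n) ℂ) (V : Set M) : Prop where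
  unitary : ∀ x ∈ V, s x ∈ Matrix.unitaryGroup (Fin n) ℂ
  smooth : ∀ i j, ContMDiffOn 𝓘(ℝ, ℂ × ℂ) 𝓘(ℝ, ℂ) ∞ (fun x => s x i j) V

end Forms

/-! ## Hermitian vector bundles with unitary connection -/

/-- A smooth Hermitian vector bundle of rank `n` over the set `Y` with a `U(n)`-connection: unitary
frames over the members `V a` of an open cover, smooth `U(n)`-valued transition functions `u a b`
satisfying the cocycle condition, and smooth `𝔲(n)`-valued connection forms `A a` with
`A b = (u a b)⁻¹ (A a) (u a b) + (u a b)⁻¹ d (u a b)`. -/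
structure UnitaryConnection {M : Type u} [TopologicalSpace M] [ChartedSpace (ℂ × ℂ) M]
    (n : ℕ) (Y : Set M) where
  κ : Type u
  V : κ → Set M
  isOpen_V : ∀ a, IsOpen (V a)
  iUnion_V : ⋃ a, V a = Y
  u : κ → κ → M → Matrix (Fin n) (Fin n) ℂ
  u_smooth : ∀ a b, IsSmoothUnitary (u a b) (V a ∩ V b)
  u_cocycle : ∀ a b c, ∀ x ∈ V a ∩ V b ∩ V c, u a b x * u b c x = u a c x
  A : κ → Fin n → Fin n → OneForm M
  A_smooth : ∀ a i j, (A a i j).SmoothOn (V a)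
  A_skew : ∀ a, ∀ x ∈ V a, ∀ v i j, A a j i x v = -conj (A a i j x v)
  A_compat : ∀ a b, ∀ x ∈ V a ∩ V b, ∀ v,
    Matrix.of (fun i j => A a i j x v) * u a b x + matD (u a b) x v
      = u a b x * Matrix.of (fun i j => A b i j x v)

/-- The curvature `dA + A ∧ A` in the frame with index `a`; its entries are 2-forms. -/
def UnitaryConnection.curvature {M : Type u} [TopologicalSpace M] [ChartedSpace (ℂ × ℂ) M]
    {n : ℕ} {Y : Set M} (B : UnitaryConnection n Y) (a : B.κ) (i j : Fin n) : TwoForm M :=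
  fun x v v' => (B.A a i j).d x v v'
    + ∑ k, (B.A a i k x v * B.A a k j x v' - B.A a i k x v' * B.A a k j x v)

/-- `F ∧ η = 0` for the curvature `F` of the connection, as a 4-form on `Y` with values in the
endomorphisms of the bundle. -/
def UnitaryConnection.CurvatureWedgeEqZero {M : Type u} [TopologicalSpace M]
    [ChartedSpace (ℂ × ℂ) M] {n : ℕ} {Y : Set M} (B : UnitaryConnection n Y) (η : TwoForm M) :
    Prop :=
  ∀ a, ∀ x ∈ B.V a, ∀ i j v₁ v₂ v₃ v₄, (B.curvature a i j).wedge η x v₁ v₂ v₃ v₄ = 0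

/-! ## The first cohomology of the locally constant sheaf `U(1)` -/

/-- A Čech 1-cocycle, for some open cover `U` of `X`, with values in the sheaf of locally constant
`U(1)`-valued functions. The values of `g i j` outside `U i ∩ U j` are irrelevant. -/
structure CechCocycle (X : Type u) [TopologicalSpace X] where
  ι : Type u
  U : ι → Set X
  isOpen_U : ∀ i, IsOpen (U i)
  iUnion_U : ⋃ i, U i = Set.univ
  g : ι → ι → X → Circle
  locConst : ∀ i j, ∀ x ∈ U i ∩ U j, ∀ᶠ y in 𝓝 x, g i j y = g i j x
  cocycle : ∀ i j k, ∀ x ∈ U i ∩ U j ∩ U k, g i j x * g j k x = g i k x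

/-- Two cocycles, possibly for different covers, define the same class: there are locally constant
functions `s i a` on the sets `U i ∩ U' a` of the common refinement with `g s = s g'`. -/
def CechCocycle.Cohomologous {X : Type u} [TopologicalSpace X] (c c' : CechCocycle X) : Prop :=
  ∃ s : c.ι → c'.ι → X → Circle,
    (∀ i a, ∀ x ∈ c.U i ∩ c'.U a, ∀ᶠ y in 𝓝 x, s i a y = s i a x) ∧
    ∀ i j a b, ∀ x ∈ c.U i ∩ c.U j ∩ (c'.U a ∩ c'.U b),
      c.g i j x * s j b x = s i a x * c'.g a b x

/-- `H¹(X, U(1))` for the sheaf of locally constant `U(1)`-valued functions. -/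
def CechH1 (X : Type u) [TopologicalSpace X] : Type (u + 1) :=
  Quot (CechCocycle.Cohomologous (X := X))

/-! ## Elliptic fibrations with a section and a holomorphic symplectic form -/

/-- The regular values of a map from a complex surface to a complex curve. -/
def regularValues {M : Type u} {N : Type v} [TopologicalSpace M] [ChartedSpace (ℂ × ℂ) M]
    [TopologicalSpace N] [ChartedSpace ℂ N] (f : M → N) : Set N :=
  {b | ∀ x, f x = b → Function.Surjective (mfderiv 𝓘(ℂ, ℂ × ℂ) 𝓘(ℂ, ℂ) f x)}

/-- A proper holomorphic map `f` from a holomorphic symplectic surface `(M, Ω)` to a complex curve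
`N`, with connected regular fibres and a holomorphic section `σ`. Its regular fibres
are elliptic curves, since `Ω` trivializes their canonical bundles. -/
structure EllipticFibration (M : Type u) (N : Type v)
    [TopologicalSpace M] [ChartedSpace (ℂ × ℂ) M] [TopologicalSpace N] [ChartedSpace ℂ N] where
  f : M → N
  σ : N → M
  Ω : ∀ x : M, TangentSpace 𝓘(ℂ, ℂ × ℂ) x [⋀^Fin 2]→L[ℂ] ℂ
  f_holo : ContMDiff 𝓘(ℂ, ℂ × ℂ) 𝓘(ℂ, ℂ) ω f
  f_proper : IsProperMap f
  f_connected : ∀ b ∈ regularValues f, IsConnected (f ⁻¹' {b})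
  σ_holo : ContMDiff 𝓘(ℂ, ℂ) 𝓘(ℂ, ℂ × ℂ) ω σ
  f_σ : ∀ b, f (σ b) = b
  Ω_holo : ∀ x₀ : M, DifferentiableOn ℂ (fun y =>
      Ω ((chartAt (ℂ × ℂ) x₀).symm y)
        ![mfderiv 𝓘(ℂ, ℂ × ℂ) 𝓘(ℂ, ℂ × ℂ) (chartAt (ℂ × ℂ) x₀).symm y ((1, 0) : ℂ × ℂ),
          mfderiv 𝓘(ℂ, ℂ × ℂ) 𝓘(ℂ, ℂ × ℂ) (chartAt (ℂ × ℂ) x₀).symm y ((0, 1) : ℂ × ℂ)])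
    (chartAt (ℂ × ℂ) x₀).target
  Ω_nondeg : ∀ (x : M) (v : TangentSpace 𝓘(ℂ, ℂ × ℂ) x), (∀ v', Ω x ![v, v'] = 0) → v = 0

namespace EllipticFibration

variable {M : Type u} {N : Type v} [TopologicalSpace M] [ChartedSpace (ℂ × ℂ) M]
  [TopologicalSpace N] [ChartedSpace ℂ N]

/-- The regular locus in the base. -/
def N₀ (X : EllipticFibration M N) : Set N := regularValues X.f

/-- `Ω`, as a complex valued 2-form on the underlying real manifold. -/
def ΩForm (X : EllipticFibration M N) : TwoForm M :=
  fun x v v' => X.Ω x (![v, v'] : Fin 2 → ℂ × ℂ)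

/-- The coordinates `(w, z)` of the uniformization of `f` over an open set `U ⊆ N₀`:
a holomorphic coordinate `w` on `U`, the period `τ` as a function of `w`, and the covering map
`p : w(U) × ℂ → f⁻¹(U)` over `U` which induces
`(w(U) × ℂ) / Span_ℤ {1, τ} ≅ f⁻¹(U)`, sends `z = 0` to the section `σ`, and satisfies
`p^* Ω = dw ∧ dz`. In invariant terms, `(w, z)` stands for the covector `z dw`, and `p` is the
restriction of the symplectic covering map `T^* N₀ → f⁻¹(N₀)`, whose kernel
over `U` is the lattice `Span_ℤ {dw, τ dw}`. -/
structure AdaptedChart (X : EllipticFibration M N) where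
  w : OpenPartialHomeomorph N ℂ
  w_mem : w ∈ IsManifold.maximalAtlas 𝓘(ℂ, ℂ) ω N
  source_subset : w.source ⊆ X.N₀
  τ : ℂ → ℂ
  τ_holo : DifferentiableOn ℂ τ w.target
  τ_im_pos : ∀ a ∈ w.target, 0 < (τ a).im
  p : ℂ × ℂ → M
  p_holo : ContMDiffOn 𝓘(ℂ, ℂ × ℂ) 𝓘(ℂ, ℂ × ℂ) ω p (w.target ×ˢ Set.univ)
  f_p : ∀ a ∈ w.target, ∀ z, X.f (p (a, z)) = w.symm a
  p_zero : ∀ a ∈ w.target, p (a, 0) = X.σ (w.symm a)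
  p_surj : ∀ x, X.f x ∈ w.source → ∃ z, p (w (X.f x), z) = x
  p_eq_iff : ∀ a ∈ w.target, ∀ z z',
    p (a, z) = p (a, z') ↔ ∃ k l : ℤ, z' - z = k + l * τ a
  pullback_Ω : ∀ a ∈ w.target, ∀ (z : ℂ) (v v' : ℂ × ℂ),
    X.ΩForm (p (a, z)) (mfderiv 𝓘(ℝ, ℂ × ℂ) 𝓘(ℝ, ℂ × ℂ) p (a, z) v)
      (mfderiv 𝓘(ℝ, ℂ × ℂ) 𝓘(ℝ, ℂ × ℂ) p (a, z) v') = v.1 * v'.2 - v'.1 * v.2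

namespace AdaptedChart

variable {X : EllipticFibration M N} (c : AdaptedChart X)

/-- The differential of `p`, on real tangent vectors. -/
def dp (y : ℂ × ℂ) : (ℂ × ℂ) →L[ℝ] TangentSpace 𝓘(ℝ, ℂ × ℂ) (c.p y) :=
  mfderiv 𝓘(ℝ, ℂ × ℂ) 𝓘(ℝ, ℂ × ℂ) c.p y

/-- `θ = dz + b dw` with `b = - (Im z / Im τ) ∂τ/∂w`, at the point `y = (w, z)`. -/
def θ (y v : ℂ × ℂ) : ℂ :=
  v.2 + (-((y.2.im / (c.τ y.1).im : ℝ) : ℂ) * deriv c.τ y.1) * v.1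

/-- `(i/2) (t W θ ∧ θ̄ + W⁻¹ dw ∧ dw̄)` with `W = (Im τ)⁻¹`, at the point `y = (w, z)`. -/
def semiFlat (t : ℝ) (y v v' : ℂ × ℂ) : ℂ :=
  Complex.I / 2 *
    (t * ((c.τ y.1).im : ℂ)⁻¹ * (c.θ y v * conj (c.θ y v') - c.θ y v' * conj (c.θ y v))
      + ((c.τ y.1).im : ℂ) * (v.1 * conj v'.1 - v'.1 * conj v.1))

/-- The flat connection form `π (Im τ)⁻¹ (q θ̄ - q̄ θ)` on the trivial line bundle. -/
def lineConnection (q : ℂ → ℂ) (y v : ℂ × ℂ) : ℂ :=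
  Real.pi * ((c.τ y.1).im : ℂ)⁻¹ * (q y.1 * conj (c.θ y v) - conj (q y.1) * c.θ y v)

end AdaptedChart

open Classical in
/-- The semi-flat form `ω_t^SF` on `f⁻¹(N₀)`: the 2-form whose pullback by the covering map of
any adapted chart `c` is `c.semiFlat t`. At each point it is computed in one adapted chart; the
choice does not matter, as is proved in `semiFlatForm_dp` below. -/
def semiFlatForm (X : EllipticFibration M N) (t : ℝ) : TwoForm M := fun x v v' =>
  if h : ∃ cy : AdaptedChart X × (ℂ × ℂ), cy.2.1 ∈ cy.1.w.target ∧ cy.1.p cy.2 = x then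
    h.choose.1.semiFlat t h.choose.2 ((h.choose.1.dp h.choose.2).inverse v)
      ((h.choose.1.dp h.choose.2).inverse v')
  else 0

/-! ## The Fourier–Mukai transform -/

/-- `D` is a smooth holomorphic curve in `f⁻¹(N')` such that `f : D → N'` is an unbranched
covering with `n` sheets: locally over `N'` it is the disjoint union of the images of `n`
holomorphic sections. -/
structure IsUnbranchedMultisection (X : EllipticFibration M N) (N' : Set N) (D : Set M) (n : ℕ) :
    Prop where
  subset : D ⊆ X.f ⁻¹' N'
  locally_sections : ∀ b ∈ N', ∃ V ⊆ N', IsOpen V ∧ b ∈ V ∧ ∃ s : Fin n → N → M,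
    (∀ j, ContMDiffOn 𝓘(ℂ, ℂ) 𝓘(ℂ, ℂ × ℂ) ω (s j) V) ∧
    (∀ j, ∀ b' ∈ V, X.f (s j b') = b') ∧
    (∀ b' ∈ V, Function.Injective fun j => s j b') ∧
    ∀ x, X.f x ∈ V → (x ∈ D ↔ ∃ j, s j (X.f x) = x)

/-- The local data from which the Fourier–Mukai transform of `(D, Θ)` is formed: a cover of `N'` by
the domains of adapted charts over which `D` is the disjoint union of the graphs of `n` holomorphic
functions `q l j`, and a cocycle which represents `Θ` on the resulting cover of `D` by sheets. -/
structure FMData (X : EllipticFibration M N) (N' : Set N) (D : Set M) (n : ℕ) (Θ : CechH1 D) where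
  ι : Type u
  chart : ι → AdaptedChart X
  iUnion_source : ⋃ l, (chart l).w.source = N'
  q : ι → Fin n → ℂ → ℂ
  q_holo : ∀ l j, DifferentiableOn ℂ (q l j) (chart l).w.target
  q_injective : ∀ l, ∀ a ∈ (chart l).w.target,
    Function.Injective fun j => (chart l).p (a, q l j a)
  mem_D_iff : ∀ l x, X.f x ∈ (chart l).w.source →
    (x ∈ D ↔ ∃ j, (chart l).p ((chart l).w (X.f x), q l j ((chart l).w (X.f x))) = x)
  cocycle : CechCocycle D
  index : ι × Fin n ≃ cocycle.ι
  U_index : ∀ l j, cocycle.U (index (l, j)) =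
    {x : D | X.f x ∈ (chart l).w.source ∧
      (chart l).p ((chart l).w (X.f x), q l j ((chart l).w (X.f x))) = x}
  mk_cocycle : Quot.mk _ cocycle = Θ

namespace FMData

variable {X : EllipticFibration M N} {N' : Set N} {D : Set M} {n : ℕ} {Θ : CechH1 D}
  (S : FMData X N' D n Θ)

/-- The lift `q l j`, minus the lift `q m i` rewritten in the coordinate of the chart `l`, at the
point `a` of the latter. It is an element of the lattice if the two
lifts describe the same point of `D`. -/
def shift (m l : S.ι) (i j : Fin n) (a : ℂ) : ℂ :=
  S.q l j a - deriv (fun a' => (S.chart m).w ((S.chart l).w.symm a')) a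
    * S.q m i ((S.chart m).w ((S.chart l).w.symm a))

open Classical in
/-- The transition function from the frame over chart `l` to the frame over chart `m` of the
push-forward to `f⁻¹(N')` of the line bundle on `D ×_{N'} f⁻¹(N')` which is the tensor product of
the restricted Poincaré bundle and the flat bundle of `Θ`, at the point `(a, z)` of chart `l`. The
entry `(i, j)` is nonzero only if sheet `i` over `m` and sheet `j` over `l` meet over that point;
then it is the value of the cocycle of `Θ`, times the transition function
`exp (2 π i (s y₁ - r y₂))`, `z = y₁ + τ y₂`, of the Poincaré bundle
when the two lifts differ by the lattice element `r + s τ` (so just the value of the cocycle if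
the lifts agree). -/
def transition (m l : S.ι) (a z : ℂ) : Matrix (Fin n) (Fin n) ℂ :=
  Matrix.of fun i j =>
    if h : (S.chart l).p (a, S.q l j a) ∈ D ∧
        (S.chart m).p ((S.chart m).w ((S.chart l).w.symm a),
          S.q m i ((S.chart m).w ((S.chart l).w.symm a))) = (S.chart l).p (a, S.q l j a) then
      (S.cocycle.g (S.index (m, i)) (S.index (l, j)) ⟨(S.chart l).p (a, S.q l j a), h.1⟩ : ℂ)
        * Complex.exp (2 * Real.pi * Complex.I *
            (((S.shift m l i j a * conj z).im / ((S.chart l).τ a).im : ℝ) : ℂ))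
    else 0

end FMData

/-- The Fourier–Mukai transform of `(D, Θ)`: all unitary connections on Hermitian bundles over
`f⁻¹(N')` which are unitarily gauge equivalent to the connection given over the adapted charts of
some `S : FMData` by `Ξ = diag (π (Im τ)⁻¹ (q_j θ̄ - q̄_j θ))`, on the bundle
with transition functions `S.transition`. The gauge equivalence is a
family of smooth maps `s k l` to `U(n)` that intertwines the transition functions and transforms
the connection forms into each other. -/
def FourierMukai (X : EllipticFibration M N) (N' : Set N) (D : Set M) (n : ℕ) (Θ : CechH1 D) :
    Set (UnitaryConnection n (X.f ⁻¹' N')) :=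
  {B | ∃ (S : FMData X N' D n Θ) (s : B.κ → S.ι → M → Matrix (Fin n) (Fin n) ℂ),
    (∀ k l, IsSmoothUnitary (s k l) (B.V k ∩ X.f ⁻¹' (S.chart l).w.source)) ∧
    (∀ k k' m l, ∀ a ∈ (S.chart l).w.target, ∀ z,
      (S.chart l).p (a, z) ∈ B.V k ∩ B.V k' →
      (S.chart l).w.symm a ∈ (S.chart m).w.source →
      B.u k k' ((S.chart l).p (a, z)) * s k' l ((S.chart l).p (a, z))
        = s k m ((S.chart l).p (a, z)) * S.transition m l a z) ∧
    (∀ k l, ∀ a ∈ (S.chart l).w.target, ∀ z, (S.chart l).p (a, z) ∈ B.V k →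
      ∀ v : ℂ × ℂ,
      Matrix.of (fun i j => B.A k i j ((S.chart l).p (a, z)) ((S.chart l).dp (a, z) v))
          * s k l ((S.chart l).p (a, z))
        + matD (s k l) ((S.chart l).p (a, z)) ((S.chart l).dp (a, z) v)
        = s k l ((S.chart l).p (a, z))
          * Matrix.diagonal fun j => (S.chart l).lineConnection (S.q l j) (a, z) v)}

end EllipticFibration

/-! ## The semi-flat form is well defined -/

section WellDefined
open Set Filter

theorem hasMFDerivAt_real {M' : Type*} [TopologicalSpace M'] [ChartedSpace (ℂ × ℂ) M']
    {M : Type*} [TopologicalSpace M] [ChartedSpace (ℂ × ℂ) M] {f : M' → M} {x : M'}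
    {f' : (ℂ × ℂ) →L[ℂ] (ℂ × ℂ)}
    (h : HasMFDerivAt 𝓘(ℂ, ℂ × ℂ) 𝓘(ℂ, ℂ × ℂ) f x f') :
    HasMFDerivAt 𝓘(ℝ, ℂ × ℂ) 𝓘(ℝ, ℂ × ℂ) f x (f'.restrictScalars ℝ : (ℂ × ℂ) →L[ℝ] (ℂ × ℂ)) := by
  refine ⟨h.1, ?_⟩
  have h2 := h.2
  exact HasFDerivWithinAt.restrictScalars ℝ h2

namespace EllipticFibration.AdaptedChart

variable {M : Type u} {N : Type v} [TopologicalSpace M] [ChartedSpace (ℂ × ℂ) M]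
  [TopologicalSpace N] [ChartedSpace ℂ N] {X : EllipticFibration M N} (c c' : AdaptedChart X)

theorem contMDiffAt_p {y : ℂ × ℂ} (hy : y.1 ∈ c.w.target) :
    ContMDiffAt 𝓘(ℂ, ℂ × ℂ) 𝓘(ℂ, ℂ × ℂ) ω c.p y :=
  (c.p_holo y ⟨hy, trivial⟩).contMDiffAt
    ((c.w.open_target.prod isOpen_univ).mem_nhds ⟨hy, trivial⟩)

theorem dp_hasMFDerivAt {y : ℂ × ℂ} (hy : y.1 ∈ c.w.target) :
    HasMFDerivAt 𝓘(ℝ, ℂ × ℂ) 𝓘(ℝ, ℂ × ℂ) c.p y (c.dp y) :=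
  (hasMFDerivAt_real
    ((c.contMDiffAt_p hy).mdifferentiableAt (by simp)).hasMFDerivAt).mdifferentiableAt.hasMFDerivAt

theorem Ω_dp {y : ℂ × ℂ} (hy : y.1 ∈ c.w.target) (v v' : ℂ × ℂ) :
    X.ΩForm (c.p y) (c.dp y v) (c.dp y v') = v.1 * v'.2 - v'.1 * v.2 :=
  c.pullback_Ω y.1 hy y.2 v v'

theorem dp_injective {y : ℂ × ℂ} (hy : y.1 ∈ c.w.target) :
    Function.Injective (c.dp y) := by
  rw [injective_iff_map_eq_zero]
  intro v hv
  have key : ∀ v' : ℂ × ℂ, v.1 * v'.2 - v'.1 * v.2 = 0 := fun v' => by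
    rw [← c.Ω_dp hy v v', hv]
    exact (X.Ω (c.p y)).map_coord_zero (m := (![0, c.dp y v'] : Fin 2 → ℂ × ℂ)) 0 rfl
  have h1 := key (0, 1)
  have h2 := key (1, 0)
  simp only [mul_one, zero_mul, sub_zero, mul_zero, one_mul, zero_sub, neg_eq_zero] at h1 h2
  exact Prod.ext h1 h2

theorem inverse_dp {y : ℂ × ℂ} (hy : y.1 ∈ c.w.target) (v : ℂ × ℂ) :
    (c.dp y).inverse (c.dp y v) = v := by
  let L : (ℂ × ℂ) →L[ℝ] (ℂ × ℂ) := c.dp y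
  let e : (ℂ × ℂ) ≃L[ℝ] (ℂ × ℂ) :=
    (LinearEquiv.ofInjectiveEndo (L : (ℂ × ℂ) →ₗ[ℝ] (ℂ × ℂ))
      (c.dp_injective hy)).toContinuousLinearEquiv
  have he : (e : (ℂ × ℂ) →L[ℝ] (ℂ × ℂ)) = L := ContinuousLinearMap.ext fun v => rfl
  have h1 : L.inverse = (e.symm : (ℂ × ℂ) →L[ℝ] (ℂ × ℂ)) := by
    rw [← he, ContinuousLinearMap.inverse_equiv]
  have h2 : L.inverse (L v) = v := by
    rw [h1]
    exact e.symm_apply_apply v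
  exact h2

/-- Local transition map between two adapted charts. -/
theorem exists_transition {y y' : ℂ × ℂ} (hy : y.1 ∈ c.w.target) (hy' : y'.1 ∈ c'.w.target)
    (h : c.p y = c'.p y') : ∃ H : ℂ × ℂ → ℂ × ℂ, H y = y' ∧ ContDiffAt ℂ ω H y ∧
      ∀ᶠ x in 𝓝 y, c'.p (H x) = c.p x := by
  set φ := chartAt (ℂ × ℂ) (c'.p y') with hφ
  have hφs : c'.p y' ∈ φ.source := mem_chart_source _ _
  have hφc : ContMDiffAt 𝓘(ℂ, ℂ × ℂ) 𝓘(ℂ, ℂ × ℂ) ω φ (c'.p y') :=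
    contMDiffAt_extChartAt (I := 𝓘(ℂ, ℂ × ℂ)) (x := c'.p y')
  have hP' : ContDiffAt ℂ ω (φ ∘ c'.p) y' :=
    contMDiffAt_iff_contDiffAt.1 (hφc.comp y' (c'.contMDiffAt_p hy'))
  have hP : ContDiffAt ℂ ω (φ ∘ c.p) y :=
    contMDiffAt_iff_contDiffAt.1 (ContMDiffAt.comp y (by rw [h]; exact hφc) (c.contMDiffAt_p hy))
  have hd := (hP'.differentiableAt (by simp)).hasFDerivAt
  set L := fderiv ℂ (φ ∘ c'.p) y'
  let A : (ℂ × ℂ) →L[ℝ] (ℂ × ℂ) := c'.dp y'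
  have hreal : HasFDerivAt (φ ∘ c'.p) A y' := by
    have := (c'.dp_hasMFDerivAt hy').2
    rw [modelWithCornersSelf_coe, range_id] at this
    exact hasFDerivWithinAt_univ.1 this
  have hinj : Function.Injective L := by
    have : A = L.restrictScalars ℝ := hreal.unique (hd.restrictScalars ℝ)
    have h2 := c'.dp_injective hy'
    intro a b hab
    apply h2
    have h3 : ∀ a : ℂ × ℂ, A a = L a := fun a => by
      rw [this]; rfl
    exact (h3 a).trans (hab.trans (h3 b).symm)
  let e : (ℂ × ℂ) ≃L[ℂ] (ℂ × ℂ) :=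
    (LinearEquiv.ofInjectiveEndo (L : (ℂ × ℂ) →ₗ[ℂ] (ℂ × ℂ)) hinj).toContinuousLinearEquiv
  have he : (e : (ℂ × ℂ) →L[ℂ] (ℂ × ℂ)) = L := ContinuousLinearMap.ext fun v => rfl
  rw [← he] at hd
  have hω : (ω : WithTop ℕ∞) ≠ 0 := by simp
  let g := hP'.localInverse hd hω
  have hPy : (φ ∘ c.p) y = (φ ∘ c'.p) y' := by simp [h]
  have hg : ContDiffAt ℂ ω g ((φ ∘ c.p) y) := by
    rw [hPy]; exact hP'.to_localInverse hd hω
  have hgy : g ((φ ∘ c'.p) y') = y' := hP'.localInverse_apply_image hd hω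
  have hH : ContDiffAt ℂ ω (g ∘ (φ ∘ c.p)) y := hg.comp y hP
  have hHy : (g ∘ (φ ∘ c.p)) y = y' := by
    rw [Function.comp_apply, hPy]; exact hgy
  refine ⟨g ∘ (φ ∘ c.p), hHy, hH, ?_⟩
  have e1 : ∀ᶠ x in 𝓝 y, c.p x ∈ φ.source :=
    (c.contMDiffAt_p hy).continuousAt.eventually_mem
      (φ.open_source.mem_nhds (by rw [h]; exact hφs))
  have e2 : ∀ᶠ x in 𝓝 y, c'.p ((g ∘ (φ ∘ c.p)) x) ∈ φ.source := by
    refine ContinuousAt.eventually_mem (f := fun x => c'.p ((g ∘ (φ ∘ c.p)) x)) ?_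
      (φ.open_source.mem_nhds (by rw [hHy]; exact hφs))
    exact ContinuousAt.comp (by rw [hHy]; exact (c'.contMDiffAt_p hy').continuousAt)
      hH.continuousAt
  have e3 : ∀ᶠ x in 𝓝 y, (φ ∘ c'.p) (g ((φ ∘ c.p) x)) = (φ ∘ c.p) x := by
    have := (hP'.hasStrictFDerivAt' hd hω).eventually_right_inverse
    rw [← hPy] at this
    exact hP.continuousAt.tendsto.eventually this
  filter_upwards [e1, e2, e3] with x h1 h2 h3
  exact φ.injOn h2 h1 h3


/-- Data of a local transition map `H` near a point. -/
theorem transition_fst {y : ℂ × ℂ} {H : ℂ × ℂ → ℂ × ℂ} (hy : y.1 ∈ c.w.target)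
    (hHy : (H y).1 ∈ c'.w.target) (hp : c'.p (H y) = c.p y) :
    c.w.symm y.1 ∈ c'.w.source ∧ (H y).1 = c'.w (c.w.symm y.1) := by
  have h1 := c'.f_p (H y).1 hHy (H y).2
  have h2 := c.f_p y.1 hy y.2
  rw [Prod.mk.eta] at h1 h2
  rw [hp, h2] at h1
  rw [h1]
  exact ⟨c'.w.map_target hHy, (c'.w.right_inv hHy).symm⟩

theorem dp_transition {y : ℂ × ℂ} {H : ℂ × ℂ → ℂ × ℂ} {L : (ℂ × ℂ) →L[ℂ] (ℂ × ℂ)}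
    (hy : y.1 ∈ c.w.target) (hHy : (H y).1 ∈ c'.w.target) (hH : HasFDerivAt H L y)
    (hp : ∀ᶠ x in 𝓝 y, c'.p (H x) = c.p x) (v : ℂ × ℂ) :
    (c.dp y v : ℂ × ℂ) = c'.dp (H y) (L v) := by
  have h1 : HasMFDerivAt 𝓘(ℝ, ℂ × ℂ) 𝓘(ℝ, ℂ × ℂ) H y
      (L.restrictScalars ℝ : (ℂ × ℂ) →L[ℝ] (ℂ × ℂ)) := (hH.restrictScalars ℝ).hasMFDerivAt
  have h2 := (c'.dp_hasMFDerivAt hHy).comp y h1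
  have h3 := (c.dp_hasMFDerivAt hy).congr_of_eventuallyEq (f₁ := c'.p ∘ H) hp
  have h4 := hasMFDerivAt_unique h3 h2
  exact DFunLike.congr_fun h4 v

theorem Ω_transition {y : ℂ × ℂ} {H : ℂ × ℂ → ℂ × ℂ} {L : (ℂ × ℂ) →L[ℂ] (ℂ × ℂ)}
    (hy : y.1 ∈ c.w.target) (hHy : (H y).1 ∈ c'.w.target) (hH : HasFDerivAt H L y)
    (hp : ∀ᶠ x in 𝓝 y, c'.p (H x) = c.p x) (v v' : ℂ × ℂ) :
    (L v).1 * (L v').2 - (L v').1 * (L v).2 = v.1 * v'.2 - v'.1 * v.2 := by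
  rw [← c.Ω_dp hy v v', ← c'.Ω_dp hHy (L v) (L v')]
  have h1 := c.dp_transition c' hy hHy hH hp v
  have h2 := c.dp_transition c' hy hHy hH hp v'
  have h3 : ∀ (x x' : M) (_ : x = x') (a b : ℂ × ℂ), X.ΩForm x a b = X.ΩForm x' a b := by
    rintro x _ rfl a b; rfl
  refine (h3 _ _ hp.self_of_nhds _ _).trans ?_
  exact (congrArg₂ (X.ΩForm (c.p y)) h1 h2).symm

/-- The change of the base coordinate. -/
def baseChange (a : ℂ) : ℂ := c'.w (c.w.symm a)

/-- The part of the domain of `c` that meets the domain of `c'`, in the coordinate of `c`. -/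
def overlap : Set ℂ := {a | a ∈ c.w.target ∧ c.w.symm a ∈ c'.w.source}

theorem isOpen_overlap : IsOpen (c.overlap c') :=
  (c.w.symm.trans c'.w).open_source

theorem baseChange_mem {a : ℂ} (ha : a ∈ c.overlap c') : c.baseChange c' a ∈ c'.w.target :=
  c'.w.map_source ha.2

theorem exists_z {a : ℂ} (ha : a ∈ c.overlap c') (z : ℂ) :
    ∃ z', c'.p (c.baseChange c' a, z') = c.p (a, z) := by
  have h := c.f_p a ha.1 z
  obtain ⟨z', hz'⟩ := c'.p_surj (c.p (a, z)) (by rw [h]; exact ha.2)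
  rw [h] at hz'
  exact ⟨z', hz'⟩

theorem eventually_transition {y : ℂ × ℂ} {H : ℂ × ℂ → ℂ × ℂ} (hy : y.1 ∈ c.w.target)
    (hHy : (H y).1 ∈ c'.w.target) (hH : ContDiffAt ℂ ω H y)
    (hp : ∀ᶠ x in 𝓝 y, c'.p (H x) = c.p x) :
    ∀ᶠ x in 𝓝 y, x.1 ∈ c.w.target ∧ (H x).1 ∈ c'.w.target ∧
      (∃ L : (ℂ × ℂ) →L[ℂ] (ℂ × ℂ), HasFDerivAt H L x) ∧
      (∀ᶠ x' in 𝓝 x, c'.p (H x') = c.p x') ∧ (H x).1 = c.baseChange c' x.1 := by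
  have e1 : ∀ᶠ x in 𝓝 y, x.1 ∈ c.w.target :=
    continuous_fst.continuousAt.eventually_mem (c.w.open_target.mem_nhds hy)
  have e2 : ∀ᶠ x in 𝓝 y, (H x).1 ∈ c'.w.target :=
    (hH.continuousAt.fst).eventually_mem (c'.w.open_target.mem_nhds hHy)
  have e3 := (hH.of_le (m := 1) (by simp)).eventually (by simp)
  filter_upwards [e1, e2, e3, hp.eventually_nhds] with x h1 h2 h3 h4
  exact ⟨h1, h2, ⟨_, (h3.differentiableAt (by simp)).hasFDerivAt⟩, h4,
    (c.transition_fst c' h1 h2 h4.self_of_nhds).2⟩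

theorem contDiffAt_baseChange {a : ℂ} (ha : a ∈ c.overlap c') :
    ContDiffAt ℂ ω (c.baseChange c') a := by
  obtain ⟨z', hz'⟩ := c.exists_z c' ha 0
  obtain ⟨H, hHy, hH, hp⟩ := c.exists_transition c' (y := (a, 0))
    (y' := (c.baseChange c' a, z')) ha.1 (c.baseChange_mem c' ha) hz'.symm
  have hev := c.eventually_transition c' (y := (a, 0)) ha.1
    (by rw [hHy]; exact c.baseChange_mem c' ha) hH hp
  have hcont : ContinuousAt (fun b : ℂ => (b, (0 : ℂ))) a := by fun_prop
  have h1 : ContDiffAt ℂ ω (fun b : ℂ => (H (b, 0)).1) a := by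
    have : ContDiffAt ℂ ω (fun b : ℂ => H (b, 0)) a :=
      ContDiffAt.comp a hH (by fun_prop)
    exact this.fst
  refine h1.congr_of_eventuallyEq ?_
  filter_upwards [hcont.tendsto.eventually hev] with b hb
  exact hb.2.2.2.2.symm

/-- Along the fibre a transition map is affine. -/
theorem transition_fibre {a z z' : ℂ} (ha : a ∈ c.overlap c')
    (hz : c'.p (c.baseChange c' a, z') = c.p (a, z)) :
    deriv (c.baseChange c') a ≠ 0 ∧ ∀ᶠ ζ in 𝓝 z,
      c'.p (c.baseChange c' a, z' + (deriv (c.baseChange c') a)⁻¹ * (ζ - z)) = c.p (a, ζ) := by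
  obtain ⟨H, hHy, hH, hp⟩ := c.exists_transition c' (y := (a, z))
    (y' := (c.baseChange c' a, z')) ha.1 (c.baseChange_mem c' ha) hz.symm
  have hev := c.eventually_transition c' (y := (a, z)) ha.1
    (by rw [hHy]; exact c.baseChange_mem c' ha) hH hp
  have hcont : ContinuousAt (fun ζ : ℂ => (a, ζ)) z := by fun_prop
  have hev2 := hcont.tendsto.eventually hev
  have key : ∀ x : ℂ × ℂ, (∀ᶠ x' in 𝓝 x, (H x').1 = c.baseChange c' x'.1) →
      x.1 ∈ c.overlap c' → ∀ L : (ℂ × ℂ) →L[ℂ] (ℂ × ℂ), HasFDerivAt H L x →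
      (L (1, 0)).1 = deriv (c.baseChange c') x.1 ∧ (L (0, 1)).1 = 0 := by
    intro x hx hxo L hL
    have h1 : HasFDerivAt (fun x' => (H x').1) ((ContinuousLinearMap.fst ℂ ℂ ℂ).comp L) x :=
      hL.fst
    have h2 := ((c.contDiffAt_baseChange c' hxo).differentiableAt (by simp)).hasDerivAt
    have h3 : HasFDerivAt (fun x' : ℂ × ℂ => c.baseChange c' x'.1) _ x :=
      HasFDerivAt.comp (g := c.baseChange c') (f := Prod.fst) x h2.hasFDerivAt hasFDerivAt_fst
    have h4 := h1.unique (h3.congr_of_eventuallyEq hx)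
    constructor
    · simpa using DFunLike.congr_fun h4 (1, 0)
    · simpa using DFunLike.congr_fun h4 (0, 1)
  have main : ∀ ζ : ℂ, (∀ᶠ x' in 𝓝 (a, ζ), x'.1 ∈ c.w.target ∧ (H x').1 ∈ c'.w.target ∧
      (∃ L : (ℂ × ℂ) →L[ℂ] (ℂ × ℂ), HasFDerivAt H L x') ∧
      (∀ᶠ x'' in 𝓝 x', c'.p (H x'') = c.p x'') ∧ (H x').1 = c.baseChange c' x'.1) →
      deriv (c.baseChange c') a ≠ 0 ∧
      HasDerivAt (fun ζ => (H (a, ζ)).2) (deriv (c.baseChange c') a)⁻¹ ζ := by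
    intro ζ hζ
    obtain ⟨h1, h2, ⟨L, hL⟩, h4, h5⟩ := hζ.self_of_nhds
    obtain ⟨k1, k2⟩ := key (a, ζ) (hζ.mono fun x hx => hx.2.2.2.2) ha L hL
    have hΩ := c.Ω_transition c' h1 h2 hL h4 (1, 0) (0, 1)
    rw [k1, k2] at hΩ
    simp only [zero_mul, sub_zero, mul_one] at hΩ
    refine ⟨left_ne_zero_of_mul_eq_one hΩ, ?_⟩
    have h6 : HasDerivAt (fun ζ => (H (a, ζ)).2) (L (0, 1)).2 ζ := by
      have : HasDerivAt (fun ζ : ℂ => (a, ζ)) ((0 : ℂ), (1 : ℂ)) ζ :=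
        (hasDerivAt_const ζ a).prodMk (hasDerivAt_id ζ)
      exact (HasFDerivAt.comp_hasDerivAt ζ hL this).snd
    rwa [eq_inv_of_mul_eq_one_right hΩ] at h6
  refine ⟨(main z hev.eventually_nhds.self_of_nhds).1, ?_⟩
  have hev3 := hcont.tendsto.eventually hev.eventually_nhds
  obtain ⟨ε, hε, hball⟩ := Metric.eventually_nhds_iff_ball.1 (hev3.and hev2)
  filter_upwards [Metric.ball_mem_nhds z hε] with ζ hζ
  have hd : ∀ ξ ∈ Metric.ball z ε, HasDerivWithinAt
      (fun ζ => (H (a, ζ)).2 - (deriv (c.baseChange c') a)⁻¹ * ζ) 0 (Metric.ball z ε) ξ := by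
    intro ξ hξ
    have := ((main ξ (hball ξ hξ).1).2.fun_sub
      ((hasDerivAt_id ξ).const_mul (deriv (c.baseChange c') a)⁻¹)).hasDerivWithinAt
      (s := Metric.ball z ε)
    simpa using this
  have hconst := (convex_ball z ε).is_const_of_fderivWithin_eq_zero (𝕜 := ℂ)
    (fun ξ hξ => (hd ξ hξ).differentiableWithinAt)
    (fun ξ hξ => by
      rw [((hd ξ hξ).hasFDerivWithinAt).fderivWithin
        (Metric.isOpen_ball.uniqueDiffWithinAt hξ)]; ext; simp)
    hζ (Metric.mem_ball_self hε)
  simp only [hHy] at hconst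
  have h7 : H (a, ζ) = (c.baseChange c' a, z' + (deriv (c.baseChange c') a)⁻¹ * (ζ - z)) := by
    refine Prod.ext (hball ζ hζ).2.2.2.2.2 ?_
    simp only
    linear_combination hconst
  rw [← h7]
  exact (hball ζ hζ).2.2.2.2.1.self_of_nhds

/-- The transition of uniformizing coordinates is `z ↦ (dw / dw') z` on every fibre. -/
theorem p_baseChange [T2Space M] {a : ℂ} (ha : a ∈ c.overlap c') (z : ℂ) :
    c'.p (c.baseChange c' a, (deriv (c.baseChange c') a)⁻¹ * z) = c.p (a, z) := by
  set κ := (deriv (c.baseChange c') a)⁻¹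
  have hcont : ∀ c : AdaptedChart X, ∀ a ∈ c.w.target, Continuous fun z => c.p (a, z) := by
    intro c a ha
    refine continuous_iff_continuousAt.2 fun z => ?_
    exact ContinuousAt.comp (c.contMDiffAt_p (y := (a, z)) ha).continuousAt (by fun_prop)
  have hS : IsClopen {z | c'.p (c.baseChange c' a, κ * z) = c.p (a, z)} := by
    constructor
    · exact isClosed_eq ((hcont c' _ (c.baseChange_mem c' ha)).comp (continuous_const_mul κ))
        (hcont c a ha.1)
    · rw [isOpen_iff_mem_nhds]
      intro z hz
      filter_upwards [(c.transition_fibre c' ha hz).2] with ζ hζ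
      rw [← hζ]
      congr 2
      ring
  have := hS.eq_univ ⟨0, ?_⟩
  · exact (eq_univ_iff_forall.1 this) z
  · rw [mem_ofPred_eq, mul_zero, c'.p_zero _ (c.baseChange_mem c' ha), c.p_zero _ ha.1]
    congr 1
    exact c'.w.left_inv ha.2


theorem lattice_iff {a : ℂ} (ha : a ∈ c.w.target) (z : ℂ) :
    c.p (a, z) = X.σ (c.w.symm a) ↔ ∃ k l : ℤ, z = k + l * c.τ a := by
  rw [← c.p_zero a ha, eq_comm, c.p_eq_iff a ha, sub_zero]

theorem lattice_baseChange [T2Space M] {a : ℂ} (ha : a ∈ c.overlap c') (z : ℂ) :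
    (∃ k l : ℤ, (deriv (c.baseChange c') a)⁻¹ * z = k + l * c'.τ (c.baseChange c' a)) ↔
      ∃ k l : ℤ, z = k + l * c.τ a := by
  rw [← c'.lattice_iff (c.baseChange_mem c' ha), ← c.lattice_iff ha.1, c.p_baseChange c' ha]
  have : c'.w.symm (c.baseChange c' a) = c.w.symm a := c'.w.left_inv ha.2
  rw [this]

theorem deriv_baseChange_ne_zero {a : ℂ} (ha : a ∈ c.overlap c') :
    deriv (c.baseChange c') a ≠ 0 := by
  obtain ⟨z', hz'⟩ := c.exists_z c' ha 0
  exact (c.transition_fibre c' ha hz').1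

/-- The lattices of two adapted charts are related by an element of `SL(2, ℤ)`, so the
imaginary parts of the periods are related as follows. -/
theorem im_τ_baseChange [T2Space M] {a : ℂ} (ha : a ∈ c.overlap c') :
    (c.τ a).im = (c'.τ (c.baseChange c' a)).im * Complex.normSq (deriv (c.baseChange c') a) := by
  set T := deriv (c.baseChange c') a with hT
  set τ' := c'.τ (c.baseChange c' a)
  have hT0 : T ≠ 0 := c.deriv_baseChange_ne_zero c' ha
  have hτ := c.τ_im_pos a ha.1
  have hτ' : 0 < τ'.im := c'.τ_im_pos _ (c.baseChange_mem c' ha)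
  obtain ⟨α, β, h1⟩ := (c.lattice_baseChange c' ha 1).2 ⟨1, 0, by simp⟩
  obtain ⟨γ, δ, h2⟩ := (c.lattice_baseChange c' ha (c.τ a)).2 ⟨0, 1, by simp⟩
  obtain ⟨α', β', h3⟩ := (c.lattice_baseChange c' ha T).1 ⟨1, 0, by simp [← hT, hT0]⟩
  obtain ⟨γ', δ', h4⟩ := (c.lattice_baseChange c' ha (T * τ')).1
    ⟨0, 1, by rw [← hT]; field_simp; simp [τ']⟩
  rw [← hT, mul_one] at h1
  rw [← hT] at h2
  change T⁻¹ = α + β * τ' at h1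
  change T⁻¹ * c.τ a = γ + δ * τ' at h2
  have hn : 0 < Complex.normSq T := Complex.normSq_pos.2 hT0
  have hn' : Complex.normSq T⁻¹ = (Complex.normSq T)⁻¹ := map_inv₀ _ _
  have e1 : (c.τ a).im * Complex.normSq T⁻¹ = ((α * δ - β * γ : ℤ) : ℝ) * τ'.im := by
    have : (c.τ a).im * Complex.normSq T⁻¹ = (T⁻¹ * c.τ a * conj T⁻¹).im := by
      simp only [Complex.normSq_apply, Complex.mul_im, Complex.mul_re, Complex.conj_re,
        Complex.conj_im]
      ring
    rw [this, h2, h1]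
    simp only [map_add, map_mul, Complex.mul_im, Complex.mul_re, Complex.add_re, Complex.add_im,
      Complex.conj_re, Complex.conj_im, Complex.intCast_re, Complex.intCast_im]
    push_cast
    ring
  have e2 : τ'.im * Complex.normSq T = ((α' * δ' - β' * γ' : ℤ) : ℝ) * (c.τ a).im := by
    have : τ'.im * Complex.normSq T = (T * τ' * conj T).im := by
      simp only [Complex.normSq_apply, Complex.mul_im, Complex.mul_re, Complex.conj_re,
        Complex.conj_im]
      ring
    rw [this, h4, h3]
    simp only [map_add, map_mul, Complex.mul_im, Complex.mul_re, Complex.add_re, Complex.add_im,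
      Complex.conj_re, Complex.conj_im, Complex.intCast_re, Complex.intCast_im]
    push_cast
    ring
  rw [hn'] at e1
  set d := α * δ - β * γ
  set d' := α' * δ' - β' * γ'
  have hd : (0 : ℝ) < d := by
    have : 0 < (d : ℝ) * τ'.im := by rw [← e1]; positivity
    exact pos_of_mul_pos_left this hτ'.le
  have hd' : (0 : ℝ) < d' := by
    have : 0 < (d' : ℝ) * (c.τ a).im := by rw [← e2]; positivity
    exact pos_of_mul_pos_left this hτ.le
  have hdd : (d : ℝ) * d' = 1 := by
    have h5 : (c.τ a).im = d * τ'.im * Complex.normSq T := by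
      rw [← e1]; field_simp
    have h6 : (c.τ a).im * (d * d' - 1) = 0 := by
      linear_combination (-1 : ℝ) * h5 - d * e2
    rcases mul_eq_zero.1 h6 with h | h
    · exact absurd h hτ.ne'
    · linarith
  have hd1 : d' = 1 := by
    have h7 : d * d' = 1 := by exact_mod_cast hdd
    have h8 : 0 < d' := by exact_mod_cast hd'
    rcases Int.mul_eq_one_iff_eq_one_or_neg_one.1 h7 with h | h <;> omega
  rw [hd1] at e2
  push_cast at e2
  linarith

theorem eventually_int {g : ℂ → ℝ} {a : ℂ} (hg : ContinuousAt g a)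
    (h : ∀ᶠ b in 𝓝 a, ∃ m : ℤ, g b = m) : ∃ m : ℤ, ∀ᶠ b in 𝓝 a, g b = m := by
  obtain ⟨m, hm⟩ := h.self_of_nhds
  refine ⟨m, ?_⟩
  filter_upwards [h, Metric.continuousAt_iff'.1 hg 1 one_pos] with b hb hb'
  obtain ⟨k, hk⟩ := hb
  rw [hk, hm, Real.dist_eq] at hb'
  rw [hk]
  have : |k - m| < 1 := by exact_mod_cast hb'
  have := Int.abs_lt_one_iff.1 this
  have : k = m := by omega
  rw [this]

/-- Continuous lattice valued functions have locally constant coefficients. -/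
theorem eventually_lattice {u τ : ℂ → ℂ} {a : ℂ} (hu : ContinuousAt u a) (hτ : ContinuousAt τ a)
    (hpos : ∀ᶠ b in 𝓝 a, 0 < (τ b).im) (h : ∀ᶠ b in 𝓝 a, ∃ k l : ℤ, u b = k + l * τ b) :
    ∃ k l : ℤ, ∀ᶠ b in 𝓝 a, u b = k + l * τ b := by
  have hne : (τ a).im ≠ 0 := hpos.self_of_nhds.ne'
  obtain ⟨l, hl⟩ := eventually_int (g := fun b => (u b).im / (τ b).im) (a := a)
    ((Complex.continuous_im.continuousAt.comp hu).div
      (Complex.continuous_im.continuousAt.comp hτ) hne) (by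
      filter_upwards [h, hpos] with b ⟨k, l, hb⟩ hb'
      refine ⟨l, ?_⟩
      rw [hb]
      simp [hb'.ne'])
  obtain ⟨k, hk⟩ := eventually_int (g := fun b => (u b).re - l * (τ b).re) (a := a)
    ((Complex.continuous_re.continuousAt.comp hu).sub
      (continuousAt_const.mul (Complex.continuous_re.continuousAt.comp hτ))) (by
      filter_upwards [h, hpos, hl] with b ⟨k, l', hb⟩ hb' hl
      refine ⟨k, ?_⟩
      have : (l' : ℝ) = l := by
        rw [← hl, hb]; simp [hb'.ne']
      rw [hb]
      simp [this])
  refine ⟨k, l, ?_⟩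
  filter_upwards [hk, hl, hpos] with b h1 h2 h3
  apply Complex.ext
  · simp; linarith
  · rw [div_eq_iff h3.ne'] at h2
    simp; linarith

/-- The local expressions of the semi-flat form in two adapted charts are intertwined by the
differential of the transition map. -/
theorem exists_linear_transition [T2Space M] {y y' : ℂ × ℂ} (hy : y.1 ∈ c.w.target)
    (hy' : y'.1 ∈ c'.w.target) (h : c'.p y' = c.p y) :
    ∃ L : (ℂ × ℂ) →L[ℂ] (ℂ × ℂ), (∀ v, (c.dp y v : ℂ × ℂ) = c'.dp y' (L v)) ∧
      ∀ t v v', c'.semiFlat t y' (L v) (L v') = c.semiFlat t y v v' := by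
  obtain ⟨a, z⟩ := y
  obtain ⟨a', z'⟩ := y'
  have hover : a ∈ c.overlap c' ∧ a' = c.baseChange c' a := by
    have := c.transition_fst c' (y := (a, z)) (H := fun _ => (a', z')) hy hy' h
    exact ⟨⟨hy, this.1⟩, this.2⟩
  obtain ⟨ha, rfl⟩ := hover
  set φ := c.baseChange c' with hφ
  set κ : ℂ → ℂ := fun b => (deriv φ b)⁻¹ with hκ
  have hφd := c.contDiffAt_baseChange c' ha
  have hev : ∀ᶠ b in 𝓝 a, b ∈ c.overlap c' := (c.isOpen_overlap c').mem_nhds ha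
  have hT0 := c.deriv_baseChange_ne_zero c' ha
  have hφ1 : HasDerivAt φ (deriv φ a) a := (hφd.differentiableAt (by simp)).hasDerivAt
  have hTd : DifferentiableAt ℂ (deriv φ) a := by
    have : AnalyticAt ℂ φ a := hφd.analyticAt
    exact this.deriv.differentiableAt
  have hκd : DifferentiableAt ℂ κ a := hTd.inv hT0
  have hτd : DifferentiableAt ℂ c.τ a :=
    (c.τ_holo a hy).differentiableAt (c.w.open_target.mem_nhds hy)
  have hτ'd : DifferentiableAt ℂ c'.τ (φ a) :=
    (c'.τ_holo _ hy').differentiableAt (c'.w.open_target.mem_nhds hy')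
  have hτφ : HasDerivAt (fun b => c'.τ (φ b)) (deriv c'.τ (φ a) * deriv φ a) a :=
    hτ'd.hasDerivAt.comp a hφ1
  have hpos : ∀ᶠ b in 𝓝 a, 0 < (c'.τ (φ b)).im := by
    filter_upwards [hev] with b hb
    exact c'.τ_im_pos _ (c.baseChange_mem c' hb)
  obtain ⟨α, β, h1⟩ := eventually_lattice hκd.continuousAt hτφ.continuousAt hpos (by
    filter_upwards [hev] with b hb
    have := (c.lattice_baseChange c' hb 1).2 ⟨1, 0, by simp⟩
    simpa using this)
  obtain ⟨γ, δ, h2⟩ := eventually_lattice (u := fun b => κ b * c.τ b)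
    (hκd.continuousAt.mul hτd.continuousAt) hτφ.continuousAt hpos (by
    filter_upwards [hev] with b hb
    exact (c.lattice_baseChange c' hb (c.τ b)).2 ⟨0, 1, by simp⟩)
  obtain ⟨m, n, hmn⟩ : ∃ m n : ℤ, z' - κ a * z = m + n * c'.τ (φ a) := by
    rw [← c'.p_eq_iff _ hy']
    rw [h]
    exact c.p_baseChange c' ha z
  -- the transition map
  let H : ℂ × ℂ → ℂ × ℂ := fun x => (φ x.1, κ x.1 * x.2 + (m + n * c'.τ (φ x.1)))
  have hHy : H (a, z) = (φ a, z') := by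
    refine Prod.ext rfl ?_
    simp only [H]
    linear_combination -hmn
  have hHp : ∀ᶠ x in 𝓝 ((a, z) : ℂ × ℂ), c'.p (H x) = c.p x := by
    have : ∀ᶠ x in 𝓝 ((a, z) : ℂ × ℂ), x.1 ∈ c.overlap c' :=
      continuous_fst.continuousAt.eventually_mem ((c.isOpen_overlap c').mem_nhds ha)
    filter_upwards [this] with x hx
    rw [← Prod.mk.eta (p := x), ← c.p_baseChange c' hx, eq_comm,
      c'.p_eq_iff _ (c.baseChange_mem c' hx)]
    exact ⟨m, n, by simp [κ, φ]⟩
  let T := deriv φ a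
  have hk1 : deriv κ a = β * (deriv c'.τ (φ a) * T) := by
    have : HasDerivAt (fun b => (α : ℂ) + β * c'.τ (φ b)) (β * (deriv c'.τ (φ a) * T)) a :=
      (hτφ.const_mul (β : ℂ)).const_add _
    exact (this.congr_of_eventuallyEq h1).deriv
  have hk2 : deriv κ a * c.τ a + κ a * deriv c.τ a = δ * (deriv c'.τ (φ a) * T) := by
    have e1 : HasDerivAt (fun b => (γ : ℂ) + δ * c'.τ (φ b)) (δ * (deriv c'.τ (φ a) * T)) a :=
      (hτφ.const_mul (δ : ℂ)).const_add _
    have e2 := hκd.hasDerivAt.mul hτd.hasDerivAt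
    exact e2.unique (e1.congr_of_eventuallyEq h2)
  let L : (ℂ × ℂ) →L[ℂ] (ℂ × ℂ) :=
    (T • ContinuousLinearMap.fst ℂ ℂ ℂ).prod
      ((κ a) • ContinuousLinearMap.snd ℂ ℂ ℂ +
        (deriv κ a * z + n * (deriv c'.τ (φ a) * T)) • ContinuousLinearMap.fst ℂ ℂ ℂ)
  have hL : ∀ v, L v = (T * v.1, κ a * v.2 + (deriv κ a * z + n * (deriv c'.τ (φ a) * T)) * v.1) :=
    fun v => by simp [L]
  have hHL : HasFDerivAt H L (a, z) := by
    have f1 : HasFDerivAt (fun x : ℂ × ℂ => φ x.1) _ (a, z) :=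
      HasFDerivAt.comp (g := φ) (f := Prod.fst) (a, z) hφ1.hasFDerivAt hasFDerivAt_fst
    have f2 : HasFDerivAt (fun x : ℂ × ℂ => κ x.1) _ (a, z) :=
      HasFDerivAt.comp (g := κ) (f := Prod.fst) (a, z) hκd.hasDerivAt.hasFDerivAt hasFDerivAt_fst
    have f3 : HasFDerivAt (fun x : ℂ × ℂ => c'.τ (φ x.1)) _ (a, z) :=
      HasFDerivAt.comp (g := fun b => c'.τ (φ b)) (f := Prod.fst) (a, z) hτφ.hasFDerivAt
        hasFDerivAt_fst
    have f4 := f1.prodMk ((f2.mul (hasFDerivAt_snd (𝕜 := ℂ) (E := ℂ) (F := ℂ))).add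
      ((f3.const_mul (n : ℂ)).const_add (m : ℂ)))
    refine f4.congr_fderiv ?_
    ext <;> simp [L, T]
    ring
  refine ⟨L, fun v => ?_, fun t v v' => ?_⟩
  · have := c.dp_transition c' (y := (a, z)) hy (by rw [hHy]; exact hy') hHL hHp v
    rw [hHy] at this
    exact this
  have hτpos := c.τ_im_pos a hy
  have hτ'pos : 0 < (c'.τ (φ a)).im := c'.τ_im_pos _ hy'
  have him : (c.τ a).im = (c'.τ (φ a)).im * Complex.normSq T := c.im_τ_baseChange c' ha
  have hκT : κ a * T = 1 := inv_mul_cancel₀ hT0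
  have hθ : ∀ v, c'.θ (φ a, z') (L v) = κ a * c.θ (a, z) v := by
    intro v
    obtain ⟨s, hs⟩ : ∃ s : ℝ, s = z.im / (c.τ a).im := ⟨_, rfl⟩
    obtain ⟨r, hr⟩ : ∃ r : ℝ, r = z.re - s * (c.τ a).re := ⟨_, rfl⟩
    have hz : z = r + s * c.τ a := by
      apply Complex.ext
      · simp [hr]
      · simp [hs, hτpos.ne']
    have h1a : κ a = α + β * c'.τ (φ a) := h1.self_of_nhds
    have h2a : κ a * c.τ a = γ + δ * c'.τ (φ a) := h2.self_of_nhds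
    have hz' : z' = (r * α + s * γ + m : ℝ) + (r * β + s * δ + n : ℝ) * c'.τ (φ a) := by
      have : z' = κ a * z + (m + n * c'.τ (φ a)) := by linear_combination hmn
      rw [this, hz]
      push_cast
      linear_combination r * h1a + s * h2a
    have hs' : z'.im / (c'.τ (φ a)).im = r * β + s * δ + n := by
      rw [hz', div_eq_iff hτ'pos.ne']
      simp only [Complex.add_im, Complex.ofReal_im, Complex.im_ofReal_mul]
      ring
    unfold θ
    simp only [hs', ← hs, hL]
    push_cast
    have e : deriv κ a * z + n * (deriv c'.τ (φ a) * T)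
        - (r * β + s * δ + n) * (deriv c'.τ (φ a) * T) = - κ a * s * deriv c.τ a := by
      rw [hz]
      linear_combination (r : ℂ) * hk1 + s * hk2
    linear_combination v.1 * e
  unfold semiFlat
  rw [hθ, hθ, hL, hL]
  simp only [map_mul, him]
  have hTn : ((Complex.normSq T : ℝ) : ℂ) = T * conj T := (Complex.mul_conj T).symm
  have hcT : conj T ≠ 0 := by simpa using hT0
  have hτ'c : (((c'.τ (φ a)).im : ℝ) : ℂ) ≠ 0 := by exact_mod_cast hτ'pos.ne'
  have hκ' : κ a = T⁻¹ := rfl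
  have hT0' : T ≠ 0 := hT0
  rw [hκ', map_inv₀]
  push_cast
  rw [hTn]
  field_simp

end EllipticFibration.AdaptedChart

open EllipticFibration in
/-- In every adapted chart the pullback of the semi-flat form is given by its defining formula. -/
theorem EllipticFibration.semiFlatForm_dp {M : Type u} {N : Type v} [TopologicalSpace M]
    [ChartedSpace (ℂ × ℂ) M] [TopologicalSpace N] [ChartedSpace ℂ N] [T2Space M]
    (X : EllipticFibration M N) (t : ℝ) (c : AdaptedChart X) {y : ℂ × ℂ} (hy : y.1 ∈ c.w.target)
    (v v' : ℂ × ℂ) :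
    X.semiFlatForm t (c.p y) (c.dp y v) (c.dp y v') = c.semiFlat t y v v' := by
  have h : ∃ cy : AdaptedChart X × (ℂ × ℂ), cy.2.1 ∈ cy.1.w.target ∧ cy.1.p cy.2 = c.p y :=
    ⟨(c, y), hy, rfl⟩
  unfold semiFlatForm
  rw [dif_pos h]
  obtain ⟨hy', hp⟩ := h.choose_spec
  set c' := h.choose.1
  set y' := h.choose.2
  obtain ⟨L, hL, hL'⟩ := c.exists_linear_transition c' hy hy' hp
  have key : ∀ v, (c'.dp y').inverse (c.dp y v) = L v := by
    intro v
    refine Eq.trans ?_ (c'.inverse_dp hy' (L v))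
    exact congrArg (c'.dp y').inverse (hL v)
  rw [← hL', ← key, ← key]

end WellDefined

end SemiFlatFM

end

/-! Anti-self-duality is local and invariant under gauge transformations, so it can be tested on the
covering space `(w, z)` of an adapted chart, in the frame where the connection is diagonal. There
everything becomes linear algebra in real lattice coordinates. Write `z = y₁ + τ y₂` and `q = x₁ + τ
x₂` with all `xᵢ`, `yᵢ` real. Then `θ = dy₁ + τ dy₂`, and the diagonal entry `π (Im τ)⁻¹ (q θ̄ - q̄
θ)` equals `2πi (x₂ dy₁ - x₁ dy₂)` (`lineForm_apply`), with curvature `2πi (dx₂ ∧ dy₁ - dx₁ ∧ dy₂)`.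

Two facts kill the wedge products. Since `q` and `τ` are holomorphic in `w`, `dx₁ + τ dx₂ = dq - x₂
dτ` is a multiple of `dw` (`exists_fderiv_lattice_comp_fst`). Also `dz` and `θ` differ by a multiple
of `dw`, so `Ω = dw ∧ θ`. Wedging the curvature with `Ω` leaves a multiple of `(dx₁ + τ dx₂) ∧ dw ∧
dy₁ ∧ dy₂`, which is zero. In the semi-flat form, `θ ∧ θ̄` is a multiple of `dy₁ ∧ dy₂`, which
annihilates every curvature term, and `dw ∧ dw̄` annihilates `dx₁` and `dx₂`, which depend on `w`
only. The two summands vanish separately, whence the equation for every `t`.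

The passage to an arbitrary unitary frame is `formDeriv_gauge`: if `A s + ds = s l` with `l`
diagonal, then `F_A s = s dl`. As `s` is invertible and the wedge with a fixed 2-form is linear, the
vanishing carries over (`wedgeValue_eq_zero_of_conjugate`). The bridge to forms on `M` is naturality
of `d` under the covering map `p` (`d_dp`), together with surjectivity of its differential. -/

noncomputable section

namespace SemiFlatFM

universe u v

/-! ### Exterior derivatives of 1-forms and gauge transformations on a normed space. -/

section Calculus

variable {E : Type*} [NormedAddCommGroup E] [NormedSpace ℝ E]

/-- The exterior derivative of a 1-form on a normed space, as a function of two vectors. -/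
def formDeriv (α : E → E →L[ℝ] ℂ) (y v v' : E) : ℂ :=
  fderiv ℝ α y v v' - fderiv ℝ α y v' v

/-- In degree one the alternating sum defining `extDeriv` has two terms. This links the curvature,
which is stated with alternating maps, to an antisymmetrized derivative that can be computed by
hand. -/
theorem extDeriv_ofSubsingleton_apply {α : E → E →L[ℝ] ℂ} {y : E} (hα : DifferentiableAt ℝ α y)
    (v v' : E) :
    extDeriv (fun y => ContinuousAlternatingMap.ofSubsingleton ℝ E ℂ (0 : Fin 1) (α y)) y
      (![v, v'] : Fin 2 → E) = formDeriv α y v v' := by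
  have h : DifferentiableAt ℝ
      (fun y => ContinuousAlternatingMap.ofSubsingleton ℝ E ℂ (0 : Fin 1) (α y)) y :=
    ((ContinuousAlternatingMap.ofSubsingletonLIE (𝕜 := ℝ) (E := E) (F := ℂ)
      (0 : Fin 1)).toContinuousLinearEquiv.toContinuousLinearMap.differentiableAt).comp y hα
  have h1 : ∀ w : E, fderiv ℝ (fun y => α y w) y = (fderiv ℝ α y).flip w := fun w => by
    rw [fderiv_clm_apply hα (differentiableAt_const w)]
    ext; simp
  rw [extDeriv_apply h]
  simp [Fin.sum_univ_two, Fin.removeNth, formDeriv, h1, sub_eq_add_neg]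

theorem fderiv_fderiv_symm {F : Type*} [NormedAddCommGroup F] [NormedSpace ℝ F] {f : E → F} {y : E}
    (hf : ContDiffAt ℝ 2 f y) (v v' : E) :
    fderiv ℝ (fderiv ℝ f) y v v' = fderiv ℝ (fderiv ℝ f) y v' v :=
  hf.isSymmSndFDerivAt (by simp) v v'

theorem differentiableAt_fderiv {F : Type*} [NormedAddCommGroup F] [NormedSpace ℝ F] {f : E → F}
    {y : E} (hf : ContDiffAt ℝ 2 f y) : DifferentiableAt ℝ (fderiv ℝ f) y :=
  (hf.fderiv_right (m := 1) (by norm_num)).differentiableAt (by simp)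

/-- The exterior derivative commutes with pullback. -/
theorem formDeriv_pullback {β : E → E →L[ℝ] ℂ} {ψ : E → E} {y : E} (hψ : ContDiffAt ℝ 2 ψ y)
    (hβ : DifferentiableAt ℝ β (ψ y)) (v v' : E) :
    formDeriv (fun y => (β (ψ y)).comp (fderiv ℝ ψ y)) y v v'
      = formDeriv β (ψ y) (fderiv ℝ ψ y v) (fderiv ℝ ψ y v') := by
  have hψ1 : DifferentiableAt ℝ ψ y := hψ.differentiableAt (by simp)
  have h1 : HasFDerivAt (fun y => β (ψ y)) _ y := hβ.hasFDerivAt.comp y hψ1.hasFDerivAt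
  have h2 := h1.clm_comp (differentiableAt_fderiv hψ).hasFDerivAt
  unfold formDeriv
  rw [h2.fderiv]
  simp [fderiv_fderiv_symm hψ v v']

/-- The curvature of a connection that is gauge equivalent to a diagonal one. -/
theorem formDeriv_gauge {n : ℕ} {A : Fin n → Fin n → E → E →L[ℝ] ℂ} {s : Fin n → Fin n → E → ℂ}
    {l : Fin n → E → E →L[ℝ] ℂ} {y : E} (hA : ∀ i j, DifferentiableAt ℝ (A i j) y)
    (hs : ∀ i j, ContDiffAt ℝ 2 (s i j) y) (hl : ∀ j, DifferentiableAt ℝ (l j) y)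
    (h : ∀ᶠ x in 𝓝 y, ∀ i j v,
      ∑ k, A i k x v * s k j x + fderiv ℝ (s i j) x v = s i j x * l j x v)
    (v v' : E) (i j : Fin n) :
    ∑ k, (formDeriv (A i k) y v v'
        + ∑ m, (A i m y v * A m k y v' - A i m y v' * A m k y v)) * s k j y
      = s i j y * formDeriv (l j) y v v' := by
  have hs1 : ∀ i j, HasFDerivAt (s i j) (fderiv ℝ (s i j) y) y := fun i j =>
    ((hs i j).differentiableAt (by simp)).hasFDerivAt
  have apply_const : ∀ {α : E → E →L[ℝ] ℂ}, DifferentiableAt ℝ α y → ∀ w,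
      HasFDerivAt (fun x => α x w) ((fderiv ℝ α y).flip w) y := fun {α} hα w => by
    have := hα.hasFDerivAt.clm_apply (hasFDerivAt_const w y)
    refine this.congr_fderiv ?_
    ext; simp
  -- The gauge equation, evaluated on a fixed vector `v'`, is differentiated at `y` in the direction
  -- `v`; this is why it is required on a neighbourhood.
  have key : ∀ i j v v',
      ∑ k, (A i k y v' * fderiv ℝ (s k j) y v + s k j y * fderiv ℝ (A i k) y v v')
        + fderiv ℝ (fderiv ℝ (s i j)) y v v'
      = s i j y * fderiv ℝ (l j) y v v' + l j y v' * fderiv ℝ (s i j) y v := fun i j v v' => by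
    have e1 := (HasFDerivAt.fun_sum (u := Finset.univ) fun k _ =>
      (apply_const (hA i k) v').mul (hs1 k j)).add
        (apply_const (differentiableAt_fderiv (hs i j)) v')
    have e2 := (hs1 i j).mul (apply_const (hl j) v')
    have e3 := e1.unique (e2.congr_of_eventuallyEq (h.mono fun x hx => hx i j v'))
    simpa using DFunLike.congr_fun e3 v
  let Am : E → Matrix (Fin n) (Fin n) ℂ := fun v => .of fun i j => A i j y v
  let dA : E → E → Matrix (Fin n) (Fin n) ℂ := fun v v' => .of fun i j => fderiv ℝ (A i j) y v v'
  let sm : Matrix (Fin n) (Fin n) ℂ := .of fun i j => s i j y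
  let ds : E → Matrix (Fin n) (Fin n) ℂ := fun v => .of fun i j => fderiv ℝ (s i j) y v
  let dds : E → E → Matrix (Fin n) (Fin n) ℂ := fun v v' =>
    .of fun i j => fderiv ℝ (fderiv ℝ (s i j)) y v v'
  let lm : E → Matrix (Fin n) (Fin n) ℂ := fun v => .diagonal fun j => l j y v
  let dl : E → E → Matrix (Fin n) (Fin n) ℂ := fun v v' =>
    .diagonal fun j => fderiv ℝ (l j) y v v'
  have g0 : ∀ v, ds v = sm * lm v - Am v * sm := fun v => by
    ext i j
    have := h.self_of_nhds i j v
    simp only [ds, sm, lm, Am, Matrix.sub_apply, Matrix.mul_apply,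
      Matrix.diagonal_apply, mul_ite, mul_zero, Finset.sum_ite_eq', Finset.mem_univ, if_true,
      Matrix.of_apply]
    linear_combination this
  have g1 : ∀ v v', Am v' * ds v + dA v v' * sm + dds v v' = sm * dl v v' + ds v * lm v' :=
    fun v v' => by
      ext i j
      have := key i j v v'
      simp only [ds, sm, lm, Am, dA, dl, dds, Matrix.add_apply, Matrix.mul_apply,
        Matrix.diagonal_apply, mul_ite, mul_zero, Finset.sum_ite_eq', Finset.mem_univ, if_true,
        Matrix.of_apply]
      rw [Finset.sum_add_distrib] at this
      simp only [mul_comm (s _ _ _)] at this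
      linear_combination this
  have g2 : dds v v' = dds v' v := by
    ext i j
    exact fderiv_fderiv_symm (hs i j) v v'
  -- Diagonal matrices commute, so `l ∧ l = 0` and the curvature of the diagonal connection is just
  -- `dl`.
  have g3 : lm v * lm v' = lm v' * lm v := by
    simp [lm, Matrix.diagonal_mul_diagonal, mul_comm]
  -- Antisymmetrizing the differentiated equation cancels the second derivatives of `s`. After `ds =
  -- s l - A s` is inserted, the mixed terms `A s l` cancel as well, and `A ∧ A` is what remains.
  have g4 : (dA v v' - dA v' v + (Am v * Am v' - Am v' * Am v)) * sm
      = sm * (dl v v' - dl v' v) := by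
    have a1 := g1 v v'
    have a2 := g1 v' v
    rw [g0] at a1 a2
    rw [g2] at a1
    have a3 : dA v v' * sm = sm * dl v v' + (sm * lm v - Am v * sm) * lm v'
        - Am v' * (sm * lm v - Am v * sm) - dds v' v := by rw [← a1]; noncomm_ring
    have a4 : dA v' v * sm = sm * dl v' v + (sm * lm v' - Am v' * sm) * lm v
        - Am v * (sm * lm v' - Am v' * sm) - dds v' v := by rw [← a2]; noncomm_ring
    rw [add_mul, sub_mul, a3, a4]
    have a5 : sm * lm v * lm v' = sm * lm v' * lm v := by rw [mul_assoc, g3, mul_assoc]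
    simp only [sub_mul, mul_sub, a5]
    noncomm_ring
  have := congrFun (congrFun g4 i) j
  simp only [sm, Am, dA, dl, Matrix.mul_apply, Matrix.add_apply, Matrix.sub_apply,
    Matrix.of_apply, Matrix.diagonal_apply] at this
  simp only [formDeriv, Finset.sum_sub_distrib]
  rw [this]
  simp [mul_sub, Finset.sum_sub_distrib]

theorem differentiableAt_smul_fderiv_sub {X₁ X₂ Y₁ Y₂ : E → ℂ} {y : E}
    (hX₁ : DifferentiableAt ℝ X₁ y) (hX₂ : DifferentiableAt ℝ X₂ y)
    (hY₁ : ContDiffAt ℝ 2 Y₁ y) (hY₂ : ContDiffAt ℝ 2 Y₂ y) (c : ℂ) :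
    DifferentiableAt ℝ (fun x => c • (X₂ x • fderiv ℝ Y₁ x - X₁ x • fderiv ℝ Y₂ x)) y :=
  ((hX₂.smul (differentiableAt_fderiv hY₁)).sub
    (hX₁.smul (differentiableAt_fderiv hY₂))).const_smul c

/-- This is `d(X dY) = dX ∧ dY`: the second derivatives of `Y₁` and `Y₂` are symmetric and drop out.
The combination is the shape of the connection form, with `X` the lattice coordinates of `q` and `Y`
those of `z`. -/
theorem formDeriv_smul_fderiv_sub {X₁ X₂ Y₁ Y₂ : E → ℂ} {y : E}
    (hX₁ : DifferentiableAt ℝ X₁ y) (hX₂ : DifferentiableAt ℝ X₂ y)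
    (hY₁ : ContDiffAt ℝ 2 Y₁ y) (hY₂ : ContDiffAt ℝ 2 Y₂ y) (c : ℂ) (v v' : E) :
    formDeriv (fun x => c • (X₂ x • fderiv ℝ Y₁ x - X₁ x • fderiv ℝ Y₂ x)) y v v'
      = c * (fderiv ℝ X₂ y v * fderiv ℝ Y₁ y v' - fderiv ℝ X₂ y v' * fderiv ℝ Y₁ y v
        - (fderiv ℝ X₁ y v * fderiv ℝ Y₂ y v' - fderiv ℝ X₁ y v' * fderiv ℝ Y₂ y v)) := by
  have h := (((hX₂.hasFDerivAt.smul (differentiableAt_fderiv hY₁).hasFDerivAt).sub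
    (hX₁.hasFDerivAt.smul (differentiableAt_fderiv hY₂).hasFDerivAt)).const_smul c)
  have h' : fderiv ℝ (fun x => c • (X₂ x • fderiv ℝ Y₁ x - X₁ x • fderiv ℝ Y₂ x)) y = _ := h.fderiv
  unfold formDeriv
  rw [h']
  simp only [smul_apply, sub_apply,
    add_apply, ContinuousLinearMap.smulRight_apply, smul_eq_mul,
    fderiv_fderiv_symm hY₁ v v', fderiv_fderiv_symm hY₂ v v']
  ring

end Calculus

/-! ### Real coordinates with respect to the moving lattice basis `1, τ`. -/

section LatticeCoordinates

variable {E : Type*} [NormedAddCommGroup E] [NormedSpace ℝ E]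

/-- The real function `y₂` in `g = y₁ + y₂ T`, with complex values. -/
def latticeSnd (T g : E → ℂ) (y : E) : ℂ := (((g y).im / (T y).im : ℝ) : ℂ)

/-- The real function `y₁` in `g = y₁ + y₂ T`, with complex values. -/
def latticeFst (T g : E → ℂ) (y : E) : ℂ := (((g y).re - (g y).im / (T y).im * (T y).re : ℝ) : ℂ)

theorem lattice_decomposition {E : Type*} (T g : E → ℂ) {y : E} (hT : (T y).im ≠ 0) :
    g y = latticeFst T g y + latticeSnd T g y * T y := by
  apply Complex.ext
  · simp [latticeFst, latticeSnd]
  · simp [latticeFst, latticeSnd, hT]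

theorem contDiffAt_latticeSnd_real {T g : E → ℂ} {y : E} (hT : ContDiffAt ℝ 2 T y)
    (hg : ContDiffAt ℝ 2 g y) (h : (T y).im ≠ 0) :
    ContDiffAt ℝ 2 (fun y => (g y).im / (T y).im) y :=
  (Complex.imCLM.contDiff.contDiffAt.comp y hg).div (Complex.imCLM.contDiff.contDiffAt.comp y hT) h

theorem contDiffAt_latticeFst_real {T g : E → ℂ} {y : E} (hT : ContDiffAt ℝ 2 T y)
    (hg : ContDiffAt ℝ 2 g y) (h : (T y).im ≠ 0) :
    ContDiffAt ℝ 2 (fun y => (g y).re - (g y).im / (T y).im * (T y).re) y :=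
  (Complex.reCLM.contDiff.contDiffAt.comp y hg).sub ((contDiffAt_latticeSnd_real hT hg h).mul
    (Complex.reCLM.contDiff.contDiffAt.comp y hT))

theorem contDiffAt_latticeSnd {T g : E → ℂ} {y : E} (hT : ContDiffAt ℝ 2 T y)
    (hg : ContDiffAt ℝ 2 g y) (h : (T y).im ≠ 0) : ContDiffAt ℝ 2 (latticeSnd T g) y :=
  Complex.ofRealCLM.contDiff.contDiffAt.comp y (contDiffAt_latticeSnd_real hT hg h)

theorem contDiffAt_latticeFst {T g : E → ℂ} {y : E} (hT : ContDiffAt ℝ 2 T y)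
    (hg : ContDiffAt ℝ 2 g y) (h : (T y).im ≠ 0) : ContDiffAt ℝ 2 (latticeFst T g) y :=
  Complex.ofRealCLM.contDiff.contDiffAt.comp y (contDiffAt_latticeFst_real hT hg h)

/-- Reality of the differentials `dxᵢ`, `dyᵢ` is what makes conjugation act on `τ` alone, so that
`θ̄ = dy₁ + τ̄ dy₂`. -/
theorem conj_fderiv_ofReal {r : E → ℝ} {y : E} (hr : DifferentiableAt ℝ r y) (v : E) :
    conj (fderiv ℝ (fun x => (r x : ℂ)) y v) = fderiv ℝ (fun x => (r x : ℂ)) y v := by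
  have h : HasFDerivAt (fun x => (r x : ℂ)) (Complex.ofRealCLM.comp (fderiv ℝ r y)) y :=
    Complex.ofRealCLM.hasFDerivAt.comp y hr.hasFDerivAt
  rw [h.fderiv]
  simp

theorem conj_fderiv_latticeSnd {T g : E → ℂ} {y : E} (hT : ContDiffAt ℝ 2 T y)
    (hg : ContDiffAt ℝ 2 g y) (h : (T y).im ≠ 0) (v : E) :
    conj (fderiv ℝ (latticeSnd T g) y v) = fderiv ℝ (latticeSnd T g) y v :=
  conj_fderiv_ofReal ((contDiffAt_latticeSnd_real hT hg h).differentiableAt (by simp)) v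

theorem conj_fderiv_latticeFst {T g : E → ℂ} {y : E} (hT : ContDiffAt ℝ 2 T y)
    (hg : ContDiffAt ℝ 2 g y) (h : (T y).im ≠ 0) (v : E) :
    conj (fderiv ℝ (latticeFst T g) y v) = fderiv ℝ (latticeFst T g) y v :=
  conj_fderiv_ofReal ((contDiffAt_latticeFst_real hT hg h).differentiableAt (by simp)) v

/-- Differentiate `g = g₁ + g₂ T` and move the term `g₂ dT` to the other side. For `g = z` the
result is `θ`; for `g = q` it is a multiple of `dw`. -/
theorem fderiv_lattice_decomposition {T g : E → ℂ} {y : E} (hT : ContDiffAt ℝ 2 T y)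
    (hg : ContDiffAt ℝ 2 g y) (h : (T y).im ≠ 0) (v : E) :
    fderiv ℝ (latticeFst T g) y v + T y * fderiv ℝ (latticeSnd T g) y v
      = fderiv ℝ g y v - latticeSnd T g y * fderiv ℝ T y v := by
  have h1 := ((contDiffAt_latticeFst hT hg h).differentiableAt (by simp)).hasFDerivAt
  have h2 := ((contDiffAt_latticeSnd hT hg h).differentiableAt (by simp)).hasFDerivAt
  have hev : ∀ᶠ x in 𝓝 y, (T x).im ≠ 0 :=
    (Complex.continuous_im.continuousAt.comp hT.continuousAt).eventually_ne h
  have h3 := (h1.add (h2.mul (hT.differentiableAt (by simp)).hasFDerivAt)).congr_of_eventuallyEq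
    (f₁ := g) (hev.mono fun x hx => lattice_decomposition T g hx)
  rw [h3.fderiv]
  simp only [add_apply, smul_apply, smul_eq_mul]
  ring

end LatticeCoordinates

/-- The value on four vectors of the wedge product of two alternating bilinear forms. -/
def wedgeValue {V : Type*} (F G : V → V → ℂ) (v₁ v₂ v₃ v₄ : V) : ℂ :=
  F v₁ v₂ * G v₃ v₄ - F v₁ v₃ * G v₂ v₄ + F v₁ v₄ * G v₂ v₃
    + F v₂ v₃ * G v₁ v₄ - F v₂ v₄ * G v₁ v₃ + F v₃ v₄ * G v₁ v₂

/-! ### The diagonal entries of the connection over an adapted chart, and their curvature. -/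

namespace EllipticFibration.AdaptedChart

variable {M : Type u} {N : Type v} [TopologicalSpace M] [ChartedSpace (ℂ × ℂ) M]
  [TopologicalSpace N] [ChartedSpace ℂ N] {X : EllipticFibration M N} (c : AdaptedChart X)

/-- The period as a function of both coordinates. -/
def period (y : ℂ × ℂ) : ℂ := c.τ y.1

theorem hasFDerivAt_comp_fst {g : ℂ → ℂ} (hg : DifferentiableOn ℂ g c.w.target) {y : ℂ × ℂ}
    (hy : y.1 ∈ c.w.target) :
    HasFDerivAt (𝕜 := ℝ) (fun y : ℂ × ℂ => g y.1)
      ((deriv g y.1 • ContinuousLinearMap.fst ℂ ℂ ℂ).restrictScalars ℝ) y := by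
  have h1 := (hg.differentiableAt (c.w.open_target.mem_nhds hy)).hasDerivAt
  have h2 : HasFDerivAt (fun y : ℂ × ℂ => g y.1) _ y :=
    HasFDerivAt.comp (g := g) (f := Prod.fst) y h1.hasFDerivAt hasFDerivAt_fst
  refine (h2.restrictScalars ℝ).congr_fderiv ?_
  ext v <;> simp [mul_comm]

theorem contDiffAt_comp_fst {g : ℂ → ℂ} (hg : DifferentiableOn ℂ g c.w.target) {y : ℂ × ℂ}
    (hy : y.1 ∈ c.w.target) : ContDiffAt ℝ 2 (fun y : ℂ × ℂ => g y.1) y := by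
  have h1 : ContDiffAt ℂ 2 g y.1 :=
    (hg.analyticAt (c.w.open_target.mem_nhds hy)).contDiffAt
  have h2 : ContDiffAt ℂ 2 (fun y : ℂ × ℂ => g y.1) y :=
    ContDiffAt.comp (g := g) (f := Prod.fst) y h1 contDiffAt_fst
  exact h2.restrict_scalars ℝ

/-- The connection form `2 π i (x₂ dy₁ - x₁ dy₂)`, where `q = x₁ + τ x₂` and `z = y₁ + τ y₂`. -/
def lineForm (q : ℂ → ℂ) (y : ℂ × ℂ) : (ℂ × ℂ) →L[ℝ] ℂ :=
  (2 * Real.pi * Complex.I : ℂ) •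
    (latticeSnd c.period (fun y => q y.1) y • fderiv ℝ (latticeFst c.period Prod.snd) y
      - latticeFst c.period (fun y => q y.1) y • fderiv ℝ (latticeSnd c.period Prod.snd) y)

variable {c} {q : ℂ → ℂ} {y : ℂ × ℂ}

theorem period_im_ne_zero (hy : y.1 ∈ c.w.target) : (c.period y).im ≠ 0 :=
  (c.τ_im_pos _ hy).ne'

theorem contDiffAt_period (hy : y.1 ∈ c.w.target) : ContDiffAt ℝ 2 c.period y :=
  c.contDiffAt_comp_fst c.τ_holo hy

theorem fderiv_period (hy : y.1 ∈ c.w.target) (v : ℂ × ℂ) :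
    fderiv ℝ c.period y v = deriv c.τ y.1 * v.1 := by
  have : HasFDerivAt c.period _ y := c.hasFDerivAt_comp_fst c.τ_holo hy
  rw [this.fderiv]
  simp

/-- The coefficient `Im z / Im τ` in `θ` is the coordinate `y₂`, so `θ = dz - y₂ dτ`. -/
theorem θ_eq (hy : y.1 ∈ c.w.target) (v : ℂ × ℂ) :
    c.θ y v = fderiv ℝ (latticeFst c.period Prod.snd) y v
      + c.period y * fderiv ℝ (latticeSnd c.period Prod.snd) y v := by
  rw [fderiv_lattice_decomposition (contDiffAt_period hy) contDiffAt_snd (period_im_ne_zero hy),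
    fderiv_period hy, fderiv_snd]
  simp only [θ, latticeSnd, period, ContinuousLinearMap.coe_snd']
  ring

/-- Expanding `q θ̄ - q̄ θ` in the real coordinates leaves `(τ - τ̄)(x₂ dy₁ - x₁ dy₂)`, and `τ - τ̄
= 2i Im τ` cancels the denominator. -/
theorem lineForm_apply (hy : y.1 ∈ c.w.target) (v : ℂ × ℂ) :
    c.lineForm q y v = c.lineConnection q y v := by
  have hτ : ((c.τ y.1).im : ℂ) ≠ 0 := by exact_mod_cast (c.τ_im_pos _ hy).ne'
  have hq : q y.1 = _ := lattice_decomposition c.period (fun y : ℂ × ℂ => q y.1)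
    (period_im_ne_zero hy)
  have hc : c.period y - conj (c.period y) = 2 * Complex.I * ((c.τ y.1).im : ℂ) := by
    rw [Complex.sub_conj]
    simp only [period]
    push_cast
    ring
  have r1 := conj_fderiv_latticeFst (contDiffAt_period hy) (contDiffAt_snd (𝕜 := ℝ))
    (period_im_ne_zero hy) v
  have r2 := conj_fderiv_latticeSnd (contDiffAt_period hy) (contDiffAt_snd (𝕜 := ℝ))
    (period_im_ne_zero hy) v
  have r3 : conj (latticeFst c.period (fun y : ℂ × ℂ => q y.1) y)
    = latticeFst c.period (fun y : ℂ × ℂ => q y.1) y := Complex.conj_ofReal _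
  have r4 : conj (latticeSnd c.period (fun y : ℂ × ℂ => q y.1) y)
    = latticeSnd c.period (fun y : ℂ × ℂ => q y.1) y := Complex.conj_ofReal _
  rw [lineConnection, θ_eq hy, hq]
  simp only [lineForm, smul_apply, sub_apply, smul_eq_mul, map_add, map_mul, r1, r2, r3, r4]
  field_simp
  linear_combination (-1 : ℂ) *
    (latticeSnd c.period (fun y => q y.1) y * fderiv ℝ (latticeFst c.period Prod.snd) y v
      - latticeFst c.period (fun y => q y.1) y * fderiv ℝ (latticeSnd c.period Prod.snd) y v) * hc

theorem differentiableAt_lineForm (hq : DifferentiableOn ℂ q c.w.target)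
    (hy : y.1 ∈ c.w.target) : DifferentiableAt ℝ (c.lineForm q) y :=
  differentiableAt_smul_fderiv_sub
    ((contDiffAt_latticeFst (contDiffAt_period hy) (c.contDiffAt_comp_fst hq hy)
      (period_im_ne_zero hy)).differentiableAt (by simp))
    ((contDiffAt_latticeSnd (contDiffAt_period hy) (c.contDiffAt_comp_fst hq hy)
      (period_im_ne_zero hy)).differentiableAt (by simp))
    (contDiffAt_latticeFst (contDiffAt_period hy) contDiffAt_snd (period_im_ne_zero hy))
    (contDiffAt_latticeSnd (contDiffAt_period hy) contDiffAt_snd (period_im_ne_zero hy)) _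

theorem formDeriv_lineForm (hq : DifferentiableOn ℂ q c.w.target) (hy : y.1 ∈ c.w.target)
    (v v' : ℂ × ℂ) :
    formDeriv (c.lineForm q) y v v' = 2 * Real.pi * Complex.I *
      (fderiv ℝ (latticeSnd c.period fun y => q y.1) y v
          * fderiv ℝ (latticeFst c.period Prod.snd) y v'
        - fderiv ℝ (latticeSnd c.period fun y => q y.1) y v'
          * fderiv ℝ (latticeFst c.period Prod.snd) y v
        - (fderiv ℝ (latticeFst c.period fun y => q y.1) y v
            * fderiv ℝ (latticeSnd c.period Prod.snd) y v'
          - fderiv ℝ (latticeFst c.period fun y => q y.1) y v'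
            * fderiv ℝ (latticeSnd c.period Prod.snd) y v)) :=
  formDeriv_smul_fderiv_sub
    ((contDiffAt_latticeFst (contDiffAt_period hy) (c.contDiffAt_comp_fst hq hy)
      (period_im_ne_zero hy)).differentiableAt (by simp))
    ((contDiffAt_latticeSnd (contDiffAt_period hy) (c.contDiffAt_comp_fst hq hy)
      (period_im_ne_zero hy)).differentiableAt (by simp))
    (contDiffAt_latticeFst (contDiffAt_period hy) contDiffAt_snd (period_im_ne_zero hy))
    (contDiffAt_latticeSnd (contDiffAt_period hy) contDiffAt_snd (period_im_ne_zero hy)) _ v v'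

/-- `dq - x₂ dτ` is a multiple of `dw`. -/
theorem exists_fderiv_lattice_comp_fst (hq : DifferentiableOn ℂ q c.w.target)
    (hy : y.1 ∈ c.w.target) :
    ∃ κ : ℂ, ∀ v : ℂ × ℂ, fderiv ℝ (latticeFst c.period fun y => q y.1) y v
      + c.period y * fderiv ℝ (latticeSnd c.period fun y => q y.1) y v = κ * v.1 := by
  refine ⟨deriv q y.1 - latticeSnd c.period (fun y => q y.1) y * deriv c.τ y.1, fun v => ?_⟩
  rw [fderiv_lattice_decomposition (contDiffAt_period hy) (c.contDiffAt_comp_fst hq hy)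
    (period_im_ne_zero hy), fderiv_period hy, (c.hasFDerivAt_comp_fst hq hy).fderiv]
  simp only [ContinuousLinearMap.coe_restrictScalars', smul_apply,
    ContinuousLinearMap.coe_fst', smul_eq_mul]
  ring

/-- With `dx₁ = κ dw - τ dx₂` the curvature is `2πi (dx₂ ∧ θ - κ dw ∧ dy₂)`, and both terms are
killed by `dw ∧ θ`. -/
theorem wedge_formDeriv_lineForm_Ω (hq : DifferentiableOn ℂ q c.w.target)
    (hy : y.1 ∈ c.w.target) (v₁ v₂ v₃ v₄ : ℂ × ℂ) :
    wedgeValue (formDeriv (c.lineForm q) y) (fun v v' => v.1 * v'.2 - v'.1 * v.2)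
      v₁ v₂ v₃ v₄ = 0 := by
  obtain ⟨κ, hκ⟩ := exists_fderiv_lattice_comp_fst hq hy
  have h1 : ∀ v : ℂ × ℂ, fderiv ℝ (latticeFst c.period fun y => q y.1) y v
      = κ * v.1 - c.period y * fderiv ℝ (latticeSnd c.period fun y => q y.1) y v :=
    fun v => by linear_combination hκ v
  -- Here `b = y₂ ∂τ/∂w`, the difference between `dz` and `θ`; it does not contribute to `dw ∧ dz`.
  obtain ⟨b, hb⟩ : ∃ b : ℂ, ∀ v : ℂ × ℂ, v.2 = fderiv ℝ (latticeFst c.period Prod.snd) y v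
      + c.period y * fderiv ℝ (latticeSnd c.period Prod.snd) y v + b * v.1 :=
    ⟨((y.2.im / (c.τ y.1).im : ℝ) : ℂ) * deriv c.τ y.1, fun v => by rw [← θ_eq hy, θ]; ring⟩
  simp only [wedgeValue, formDeriv_lineForm hq hy, h1, hb]
  ring

/-- Each curvature term is some `dxᵢ ∧ dyⱼ`. It is killed by `θ ∧ θ̄`, a multiple of `dy₁ ∧ dy₂`,
and by `dw ∧ dw̄`, because `dxᵢ` lies in the span of `dw` and `dw̄`. -/
theorem wedge_formDeriv_lineForm_semiFlat (hq : DifferentiableOn ℂ q c.w.target)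
    (hy : y.1 ∈ c.w.target) (t : ℝ) (v₁ v₂ v₃ v₄ : ℂ × ℂ) :
    wedgeValue (formDeriv (c.lineForm q) y) (c.semiFlat t y) v₁ v₂ v₃ v₄ = 0 := by
  obtain ⟨κ, hκ⟩ := exists_fderiv_lattice_comp_fst hq hy
  have hτ : c.period y - conj (c.period y) ≠ 0 := by
    rw [Complex.sub_conj]
    have := period_im_ne_zero hy
    simp [this]
  have hκ' : ∀ v : ℂ × ℂ, fderiv ℝ (latticeFst c.period fun y => q y.1) y v
      + conj (c.period y) * fderiv ℝ (latticeSnd c.period fun y => q y.1) y v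
        = conj κ * conj v.1 := fun v => by
    rw [← map_mul, ← hκ v, map_add, map_mul,
      conj_fderiv_latticeFst (contDiffAt_period hy) (c.contDiffAt_comp_fst hq hy)
        (period_im_ne_zero hy),
      conj_fderiv_latticeSnd (contDiffAt_period hy) (c.contDiffAt_comp_fst hq hy)
        (period_im_ne_zero hy)]
  -- Subtracting the conjugate equation gives `(τ - τ̄) dx₂ = κ dw - κ̄ dw̄`.
  obtain ⟨a, b, h2⟩ : ∃ a b : ℂ, ∀ v : ℂ × ℂ,
      fderiv ℝ (latticeSnd c.period fun y => q y.1) y v = a * v.1 + b * conj v.1 := by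
    refine ⟨(c.period y - conj (c.period y))⁻¹ * κ, -(c.period y - conj (c.period y))⁻¹ * conj κ,
      fun v => ?_⟩
    field_simp
    linear_combination hκ v - hκ' v
  have h1 : ∀ v : ℂ × ℂ, fderiv ℝ (latticeFst c.period fun y => q y.1) y v
      = (κ - c.period y * a) * v.1 + (- c.period y * b) * conj v.1 := fun v => by
    linear_combination hκ v - c.period y * h2 v
  have r1 := conj_fderiv_latticeFst (contDiffAt_period hy) (contDiffAt_snd (𝕜 := ℝ))
    (period_im_ne_zero hy)
  have r2 := conj_fderiv_latticeSnd (contDiffAt_period hy) (contDiffAt_snd (𝕜 := ℝ))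
    (period_im_ne_zero hy)
  simp only [wedgeValue, formDeriv_lineForm hq hy, h1, h2, semiFlat, θ_eq hy, map_add, map_mul,
    r1, r2]
  ring

end EllipticFibration.AdaptedChart

/-! ### Pulling back forms on the surface by the covering map `p`. -/

theorem OneForm.apply_congr {M : Type*} [TopologicalSpace M] [ChartedSpace (ℂ × ℂ) M]
    (α : OneForm M) {x x' : M} (h : x = x') (v : ℂ × ℂ) : (α x v : ℂ) = α x' v := by
  subst h; rfl

namespace EllipticFibration.AdaptedChart

variable {M : Type u} {N : Type v} [TopologicalSpace M] [ChartedSpace (ℂ × ℂ) M]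
  [TopologicalSpace N] [ChartedSpace ℂ N] {X : EllipticFibration M N} (c : AdaptedChart X)
  {y : ℂ × ℂ}

theorem contMDiffAt_p_real (hy : y.1 ∈ c.w.target) :
    ContMDiffAt 𝓘(ℝ, ℂ × ℂ) 𝓘(ℝ, ℂ × ℂ) 2 c.p y := by
  have h := (c.contMDiffAt_p hy).of_le (m := 2) (by simp)
  rw [contMDiffAt_iff] at h ⊢
  exact ⟨h.1, h.2.restrict_scalars ℝ⟩

/-- The covering map `p` in the preferred chart at `p y`. -/
def localRep (y x : ℂ × ℂ) : ℂ × ℂ := chartAt (ℂ × ℂ) (c.p y) (c.p x)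

/-- The tangent space at `p y` is identified with `ℂ × ℂ` by the preferred chart at that point, so
`dp` at `y` is by definition the derivative of `p` read in this chart. -/
theorem fderiv_localRep (hy : y.1 ∈ c.w.target) (v : ℂ × ℂ) :
    fderiv ℝ (c.localRep y) y v = (c.dp y v : ℂ × ℂ) := by
  let A : (ℂ × ℂ) →L[ℝ] (ℂ × ℂ) := c.dp y
  have h : HasFDerivAt (c.localRep y) A y := by
    have := (c.dp_hasMFDerivAt hy).2
    rw [modelWithCornersSelf_coe, Set.range_id] at this
    exact hasFDerivWithinAt_univ.1 this
  exact DFunLike.congr_fun h.fderiv v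

theorem contDiffAt_localRep (hy : y.1 ∈ c.w.target) : ContDiffAt ℝ 2 (c.localRep y) y := by
  have := (contMDiffAt_iff.1 (c.contMDiffAt_p_real hy)).2
  rw [modelWithCornersSelf_coe, Set.range_id] at this
  exact contDiffWithinAt_univ.1 this

theorem eventually_mem_target (hy : y.1 ∈ c.w.target) : ∀ᶠ x in 𝓝 y, x.1 ∈ c.w.target :=
  continuous_fst.continuousAt.eventually_mem (c.w.open_target.mem_nhds hy)

theorem eventually_p_mem (hy : y.1 ∈ c.w.target) {V : Set M} (hV : IsOpen V) (h : c.p y ∈ V) :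
    ∀ᶠ x in 𝓝 y, c.p x ∈ V :=
  (c.contMDiffAt_p hy).continuousAt.eventually_mem (hV.mem_nhds h)

/-- The pullback of a 1-form by the covering map `p`, near `y`. -/
def pullback (α : OneForm M) (y x : ℂ × ℂ) : (ℂ × ℂ) →L[ℝ] ℂ :=
  (α.inChart (c.p y) (c.localRep y x)).comp (fderiv ℝ (c.localRep y) x)

/-- Near `y` the map `p` is the inverse chart composed with `localRep y`, and the chain rule
applies. The chart stays fixed while `x` varies, and a whole neighbourhood is covered, so that
identities between pulled-back forms can be differentiated. -/
theorem eventually_pullback_apply [IsManifold 𝓘(ℂ, ℂ × ℂ) ω M] (α : OneForm M)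
    (hy : y.1 ∈ c.w.target) :
    ∀ᶠ x in 𝓝 y, ∀ v : ℂ × ℂ, c.pullback α y x v = α (c.p x) (c.dp x v) := by
  set φ := chartAt (ℂ × ℂ) (c.p y) with hφ
  have e := c.eventually_p_mem hy φ.open_source (mem_chart_source _ _)
  filter_upwards [e.eventually_nhds, c.eventually_mem_target hy] with x hx hxt v
  have hxs : c.p x ∈ φ.source := hx.self_of_nhds
  have hxφ : c.localRep y x ∈ φ.target := φ.map_source hxs
  have hψ : DifferentiableAt ℝ (c.localRep y) x := by
    have h1 : ContMDiffAt 𝓘(ℂ, ℂ × ℂ) 𝓘(ℂ, ℂ × ℂ) ω φ (c.p x) :=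
      contMDiffOn_chart.contMDiffAt (φ.open_source.mem_nhds hxs)
    exact ((contMDiffAt_iff_contDiffAt.1 (h1.comp x (c.contMDiffAt_p hxt))).differentiableAt
      (by simp)).restrictScalars ℝ
  have h2 : HasMFDerivAt 𝓘(ℝ, ℂ × ℂ) 𝓘(ℝ, ℂ × ℂ) φ.symm (c.localRep y x)
      (mfderiv 𝓘(ℝ, ℂ × ℂ) 𝓘(ℝ, ℂ × ℂ) φ.symm (c.localRep y x)) := by
    have h1 : ContMDiffAt 𝓘(ℂ, ℂ × ℂ) 𝓘(ℂ, ℂ × ℂ) ω φ.symm (c.localRep y x) :=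
      contMDiffOn_chart_symm.contMDiffAt (φ.open_target.mem_nhds hxφ)
    exact (hasMFDerivAt_real
      (h1.mdifferentiableAt (by simp)).hasMFDerivAt).mdifferentiableAt.hasMFDerivAt
  have h3 := h2.comp x hψ.hasFDerivAt.hasMFDerivAt
  have h4 := (c.dp_hasMFDerivAt hxt).congr_of_eventuallyEq (f₁ := φ.symm ∘ c.localRep y)
    (hx.mono fun x' hx' => φ.left_inv hx')
  have h5 := DFunLike.congr_fun (hasMFDerivAt_unique h3 h4) v
  have h6 : φ.symm (c.localRep y x) = c.p x := φ.left_inv hxs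
  exact (congrArg (α (φ.symm (c.localRep y x))) h5).trans (α.apply_congr h6 _)

theorem differentiableAt_pullback {α : OneForm M} (hy : y.1 ∈ c.w.target) {V : Set M}
    (hα : α.SmoothOn V) (hV : c.p y ∈ V) : DifferentiableAt ℝ (c.pullback α y) y :=
  (((hα _ hV).differentiableAt (by simp)).comp y
    ((c.contDiffAt_localRep hy).differentiableAt (by simp))).clm_comp
      (differentiableAt_fderiv (c.contDiffAt_localRep hy))

/-- Both `α.d` at `p y` and `pullback α y` use the preferred chart at `p y`, so naturality of `d`
under `localRep y` is enough and no change of chart enters. -/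
theorem d_dp {α : OneForm M} (hy : y.1 ∈ c.w.target) {V : Set M} (hα : α.SmoothOn V)
    (hV : c.p y ∈ V) (v v' : ℂ × ℂ) :
    α.d (c.p y) (c.dp y v) (c.dp y v') = formDeriv (c.pullback α y) y v v' := by
  have h1 : DifferentiableAt ℝ (α.inChart (c.p y)) (c.localRep y y) :=
    (hα _ hV).differentiableAt (by simp)
  refine (extDeriv_ofSubsingleton_apply h1 _ _).trans ?_
  refine Eq.trans ?_ (formDeriv_pullback (c.contDiffAt_localRep hy) h1 v v').symm
  rw [c.fderiv_localRep hy, c.fderiv_localRep hy]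

/-- Injectivity, which comes from `p^* Ω = dw ∧ dz`, suffices in equal finite dimensions. -/
theorem dp_surjective (hy : y.1 ∈ c.w.target) : Function.Surjective (c.dp y) := by
  let L : (ℂ × ℂ) →L[ℝ] (ℂ × ℂ) := c.dp y
  exact LinearMap.surjective_of_injective (f := (L : (ℂ × ℂ) →ₗ[ℝ] (ℂ × ℂ))) (c.dp_injective hy)

theorem contDiffAt_comp_p {g : M → ℂ} {V : Set M} (hV : IsOpen V)
    (hg : ContMDiffOn 𝓘(ℝ, ℂ × ℂ) 𝓘(ℝ, ℂ) ∞ g V) (hy : y.1 ∈ c.w.target) (h : c.p y ∈ V) :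
    ContDiffAt ℝ 2 (fun x => g (c.p x)) y :=
  contMDiffAt_iff_contDiffAt.1 (((hg.contMDiffAt (hV.mem_nhds h)).of_le
    (by norm_cast)).comp y (c.contMDiffAt_p_real hy))

theorem fderiv_comp_p {g : M → ℂ} {V : Set M} (hV : IsOpen V)
    (hg : ContMDiffOn 𝓘(ℝ, ℂ × ℂ) 𝓘(ℝ, ℂ) ∞ g V) (hy : y.1 ∈ c.w.target) (h : c.p y ∈ V)
    (v : ℂ × ℂ) :
    fderiv ℝ (fun x => g (c.p x)) y v
      = (mfderiv 𝓘(ℝ, ℂ × ℂ) 𝓘(ℝ, ℂ) g (c.p y) (c.dp y v) : ℂ) := by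
  have h1 := ((hg.contMDiffAt (hV.mem_nhds h)).mdifferentiableAt (by simp)).hasMFDerivAt
  let L : (ℂ × ℂ) →L[ℝ] ℂ := (mfderiv 𝓘(ℝ, ℂ × ℂ) 𝓘(ℝ, ℂ) g (c.p y)).comp (c.dp y)
  have h2 : HasFDerivAt (fun x => g (c.p x)) L y :=
    (h1.comp y (c.dp_hasMFDerivAt hy)).hasFDerivAt
  exact DFunLike.congr_fun h2.fderiv v

end EllipticFibration.AdaptedChart

/-! ### From the diagonal frame to an arbitrary unitary frame. -/

/-- If the curvature of a connection is conjugate to a diagonal matrix of 2-forms whose wedge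
products with `η` vanish, then its wedge product with `η` vanishes. -/
theorem wedgeValue_eq_zero_of_conjugate {V : Type*} {n : ℕ} {F : Fin n → Fin n → V → V → ℂ}
    {s : Matrix (Fin n) (Fin n) ℂ} (hs : s ∈ Matrix.unitaryGroup (Fin n) ℂ)
    {l : Fin n → V → V → ℂ} {η : V → V → ℂ}
    (h : ∀ v v' i j, ∑ k, F i k v v' * s k j = s i j * l j v v') (v₁ v₂ v₃ v₄ : V)
    (hl : ∀ j, wedgeValue (l j) η v₁ v₂ v₃ v₄ = 0) (i j : Fin n) :
    wedgeValue (F i j) η v₁ v₂ v₃ v₄ = 0 := by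
  let W : Matrix (Fin n) (Fin n) ℂ := .of fun i j => wedgeValue (F i j) η v₁ v₂ v₃ v₄
  have h1 : W * s = 0 := by
    ext i j
    have e : (W * s) i j = s i j * wedgeValue (l j) η v₁ v₂ v₃ v₄ := by
      -- The wedge with `η` is linear in its first factor, so right multiplication by `s` can be
      -- moved inside it.
      calc (W * s) i j = wedgeValue (fun v v' => ∑ k, F i k v v' * s k j) η v₁ v₂ v₃ v₄ := by
            simp only [W, Matrix.mul_apply, Matrix.of_apply, wedgeValue, Finset.sum_mul,
              ← Finset.sum_sub_distrib, ← Finset.sum_add_distrib]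
            exact Finset.sum_congr rfl fun k _ => by ring
        _ = _ := by
            simp only [h, wedgeValue]
            ring
    rw [e, hl, mul_zero, Matrix.zero_apply]
  have h2 : W = 0 := by
    rw [← mul_one W, ← Matrix.mem_unitaryGroup_iff.1 hs, ← mul_assoc, h1, zero_mul]
  exact congrFun (congrFun h2 i) j

namespace EllipticFibration

variable {M : Type u} {N : Type v} [TopologicalSpace M] [ChartedSpace (ℂ × ℂ) M]
  [TopologicalSpace N] [ChartedSpace ℂ N] {X : EllipticFibration M N}

/-- The wedge product of the curvature with a 2-form `η` vanishes if it does so for the diagonal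
connections over the adapted charts. -/
theorem curvatureWedgeEqZero_of_fourierMukai [IsManifold 𝓘(ℂ, ℂ × ℂ) ω M] {N' : Set N} {D : Set M}
    {n : ℕ} {Θ : CechH1 D} {B : UnitaryConnection n (X.f ⁻¹' N')} (hB : B ∈ X.FourierMukai N' D n Θ)
    {η : TwoForm M}
    (hη : ∀ (c : AdaptedChart X) (q : ℂ → ℂ) (_ : DifferentiableOn ℂ q c.w.target)
      (y : ℂ × ℂ) (_ : y.1 ∈ c.w.target) (v₁ v₂ v₃ v₄ : ℂ × ℂ),
      wedgeValue (formDeriv (c.lineForm q) y) (fun v v' => η (c.p y) (c.dp y v) (c.dp y v'))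
        v₁ v₂ v₃ v₄ = 0) :
    B.CurvatureWedgeEqZero η := by
  obtain ⟨S, s, hs, -, hA⟩ := hB
  intro k x hx i j v₁ v₂ v₃ v₄
  have hxN : X.f x ∈ N' := by
    have : x ∈ ⋃ a, B.V a := Set.mem_iUnion_of_mem k hx
    rwa [B.iUnion_V] at this
  rw [← S.iUnion_source] at hxN
  obtain ⟨l, hl⟩ := Set.mem_iUnion.1 hxN
  obtain ⟨z, hz⟩ := (S.chart l).p_surj x hl
  -- The point `(w (f x), z)` is generalized to `y`, so that `x` can be replaced by `p y`
  -- throughout.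
  obtain ⟨y, hyx, hy⟩ : ∃ y : ℂ × ℂ, (S.chart l).p y = x ∧ y.1 ∈ (S.chart l).w.target :=
    ⟨_, hz, (S.chart l).w.map_source hl⟩
  subst hyx
  obtain ⟨v₁, rfl⟩ := (S.chart l).dp_surjective hy v₁
  obtain ⟨v₂, rfl⟩ := (S.chart l).dp_surjective hy v₂
  obtain ⟨v₃, rfl⟩ := (S.chart l).dp_surjective hy v₃
  obtain ⟨v₄, rfl⟩ := (S.chart l).dp_surjective hy v₄
  have hV : IsOpen (B.V k ∩ X.f ⁻¹' (S.chart l).w.source) :=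
    (B.isOpen_V k).inter ((S.chart l).w.open_source.preimage X.f_holo.continuous)
  have hyV : (S.chart l).p y ∈ B.V k ∩ X.f ⁻¹' (S.chart l).w.source := ⟨hx, hl⟩
  have pull : ∀ᶠ x in 𝓝 y, ∀ i j v, (S.chart l).pullback (B.A k i j) y x v
      = B.A k i j ((S.chart l).p x) ((S.chart l).dp x v) :=
    Filter.eventually_all.2 fun i => Filter.eventually_all.2 fun j =>
      (S.chart l).eventually_pullback_apply _ hy
  have gauge := formDeriv_gauge (y := y) (A := fun i j => (S.chart l).pullback (B.A k i j) y)
    (s := fun i j x => s k l ((S.chart l).p x) i j) (l := fun j => (S.chart l).lineForm (S.q l j))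
    (fun i j => (S.chart l).differentiableAt_pullback hy (B.A_smooth k i j) hx)
    (fun i j => (S.chart l).contDiffAt_comp_p hV ((hs k l).smooth i j) hy hyV)
    (fun j => AdaptedChart.differentiableAt_lineForm (S.q_holo l j) hy) (by
      -- The intertwining relation between the frames `k` and `l`, read entrywise and pulled back by
      -- `p`, is the gauge equation near `y`.
      filter_upwards [pull, (S.chart l).eventually_mem_target hy,
        (S.chart l).eventually_p_mem hy hV hyV] with x h1 h2 h3 i j v
      have h4 := congrFun (congrFun (hA k l x.1 h2 x.2 h3.1 v) i) j
      simp only [Prod.mk.eta, Matrix.add_apply, Matrix.mul_apply, Matrix.of_apply, matD,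
        Matrix.diagonal_apply, mul_ite, mul_zero, Finset.sum_ite_eq', Finset.mem_univ,
        if_true] at h4
      rw [AdaptedChart.lineForm_apply h2,
        (S.chart l).fderiv_comp_p hV ((hs k l).smooth i j) h2 h3, ← h4]
      simp only [h1]
      rfl)
  refine wedgeValue_eq_zero_of_conjugate (V := ℂ × ℂ) ((hs k l).unitary _ hyV)
    (F := fun i j v v' => B.curvature k i j ((S.chart l).p y) ((S.chart l).dp y v)
      ((S.chart l).dp y v'))
    (l := fun j => formDeriv ((S.chart l).lineForm (S.q l j)) y) (fun v v' i j => ?_) v₁ v₂ v₃ v₄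
    (fun j => hη _ _ (S.q_holo l j) y hy v₁ v₂ v₃ v₄) i j
  rw [← gauge v v' i j]
  refine Finset.sum_congr rfl fun m _ => ?_
  simp only [UnitaryConnection.curvature, (S.chart l).d_dp hy (B.A_smooth k _ _) hx,
    pull.self_of_nhds]

end EllipticFibration

end SemiFlatFM

end

/-! ### The two equations: `η` is the semi-flat form, then `Ω`. -/

theorem proposition2p8 {M : Type*} {N : Type*}
    [TopologicalSpace M] [T2Space M] [ChartedSpace (ℂ × ℂ) M]
    [IsManifold 𝓘(ℂ, ℂ × ℂ) ω M]
    [TopologicalSpace N] [T2Space N] [ChartedSpace ℂ N] [IsManifold 𝓘(ℂ, ℂ) ω N]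
    (X : SemiFlatFM.EllipticFibration M N) (N' : Set N) (hN' : IsOpen N') (hN'₀ : N' ⊆ X.N₀)
    (n : ℕ) (D : Set M) (hD : X.IsUnbranchedMultisection N' D n) (Θ : SemiFlatFM.CechH1 D)
    (Ξ : SemiFlatFM.UnitaryConnection n (X.f ⁻¹' N')) (hΞ : Ξ ∈ X.FourierMukai N' D n Θ)
    (t : ℝ) (ht : t ∈ Set.Ioc 0 1) :
    Ξ.CurvatureWedgeEqZero (X.semiFlatForm t) ∧ Ξ.CurvatureWedgeEqZero X.ΩForm := by
  constructor
  · refine SemiFlatFM.EllipticFibration.curvatureWedgeEqZero_of_fourierMukai hΞ ?_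
    intro c q hq y hy v₁ v₂ v₃ v₄
    -- The semi-flat form is defined through an arbitrarily chosen adapted chart; its independence
    -- of that choice allows its expression in the chart `c` at hand.
    simp only [X.semiFlatForm_dp t c hy]
    exact c.wedge_formDeriv_lineForm_semiFlat hq hy t v₁ v₂ v₃ v₄
  · refine SemiFlatFM.EllipticFibration.curvatureWedgeEqZero_of_fourierMukai hΞ ?_
    intro c q hq y hy v₁ v₂ v₃ v₄
    simp only [c.Ω_dp hy]
    exact c.wedge_formDeriv_lineForm_Ω hq hy v₁ v₂ v₃ v₄
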